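/- Let $n\ge 1$. For $(r,s)\in[1,n]\times\mathbb Z_{\ge1}$ let $B^{(r)}_s$ be the Kirillov–Reshetikhin crystal of type $A^{(1)}_n$, i.e. the set of semistandard tableaux of rectangular shape $(s^r)$ ($r$ rows of length $s$) with letters in $\{1,\dots,n+1\}$. For tableaux $S,T$ let $S\cdot T$ be the tableau product: the row word of $T$ (rows read from bottom to top, each from left to right) is row-inserted letter by letter into $S$. The combinatorial $R$ is the bijection $R:B^{(a)}_i\otimes B^{(r)}_s\to B^{(r)}_s\otimes B^{(a)}_i$ determined by $$R(b\otimes c)=\tilde c\otimes\tilde b\iff c\cdot b=\tilde b\cdot\tilde c .$$ Let $z_k=e^{\varpi_k}$ $(1\le k\le n)$, where $\varpi_k$ are the fundamental weights of $A_n$, and for $T\in B^{(r)}_s$ put $$e^{\mathrm{wt}(T)}=\prod_{k=1}^n z_k^{\#\{\text{letters }k\text{ in }T\}-\#\{\text{letters }k+1\text{ in }T\}},\qquad Q^{(r)}_s=\sum_{T\in B^{(r)}_s}e^{\mathrm{wt}(T)},\qquad \pi^{(r)}_s(T)=\frac{e^{\mathrm{wt}(T)}}{Q^{(r)}_s}.$$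 For $(a,i),(r,s)\in[1,n]\times\mathbb Z_{\ge1}$, consider the Markov chain of the carrier on $B^{(a)}_i$ driven by i.i.d. local states in $B^{(r)}_s$ with law $\pi^{(r)}_s$, whose transition probabilities are $$\mathrm{Rate}(u\to u')=\sum_{\substack{b,b'\in B^{(r)}_s\\ R(u\otimes b)=b'\otimes u'}}\pi^{(r)}_s(b)\qquad(u,u'\in B^{(a)}_i).$$ **Proposition 3.1.** For all $(a,i),(r,s)\in[1,n]\times\mathbb Z_{\ge1}$, the rule above does determine a bijection $R$, and one has $\sum_{u'\in B^{(a)}_i}\mathrm{Rate}(u\to u')=1$ for every $u\in B^{(a)}_i$, the normalization $\sum_{u\in B^{(a)}_i}\pi^{(a)}_i(u)=1$, and the stationarity $$\pi^{(a)}_i(u')=\sum_{u\in B^{(a)}_i}\pi^{(a)}_i(u)\,\mathrm{Rate}(u\to u')\qquad(u'\in B^{(a)}_i).$$ These identities hold in the field of rational functions $\mathbb R(z_1,\dots,z_n)$, and also for all positive real values of $z_1,\dots,z_n$, in which case moreover $\pi^{(a)}_i(u)>0$ for all $u$. -/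

import Mathlib

namespace BoxBall

/-- Row bumping of a letter `x` into a single row: the leftmost letter strictly greater than `x` is
replaced by `x` and bumped out (second component); if there is none, `x` is put at the right end. -/
def bumpRow {α : Type*} [LinearOrder α] (x : α) : List α → List α × Option α
  | [] => ([x], none)
  | y :: ys => if x < y then (x :: ys, some y) else (y :: (bumpRow x ys).1, (bumpRow x ys).2)

/-- Row insertion `U ← x` of a letter into a tableau given by its list of rows, top row first:
a letter bumped out of a row is inserted into the next row. -/
def rowInsert {α : Type*} [LinearOrder α] : List (List α) → α → List (List α)
  | [], x => [[x]]
  | row :: rows, x =>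
    match (bumpRow x row).2 with
    | none => (bumpRow x row).1 :: rows
    | some y => (bumpRow x row).1 :: rowInsert rows y

/-- The row word of a tableau: its rows are read from bottom to top, each from left to right. -/
def rowWord {α : Type*} (T : List (List α)) : List α := T.reverse.flatten

/-- The tableau product `S · T = (⋯((S ← u₁) ← u₂) ⋯) ← u_l`, where `u₁ u₂ ⋯ u_l` is the row word
of `T`. -/
def tabMul {α : Type*} [LinearOrder α] (S T : List (List α)) : List (List α) :=
  (rowWord T).foldl rowInsert S

/-- The Kirillov-Reshetikhin crystal `B^{(r)}_s` of type `A_n^{(1)}`, as a set: the semistandard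
tableaux of rectangular shape `(s^r)` (`r` rows of length `s`) with `n + 1` letters; the letter `j`
in `{1, …, n + 1}` is the element `j - 1` of `Fin (n + 1)`. -/
abbrev KR (n r s : ℕ) : Type :=
  {T : Fin r → Fin s → Fin (n + 1) //
    (∀ p q q', q ≤ q' → T p q ≤ T p q') ∧ (∀ p p' q, p < p' → T p q < T p' q)}

/-- The list of rows of a rectangular tableau, top row first. -/
def KR.rows {n r s : ℕ} (T : KR n r s) : List (List (Fin (n + 1))) :=
  List.ofFn fun p => List.ofFn (T.1 p)

open Classical in
/-- The combinatorial `R : B^{(a)}_i ⊗ B^{(r)}_s → B^{(r)}_s ⊗ B^{(a)}_i`. The image of `b ⊗ c` is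
the pair `c' ⊗ b'` with `c · b = b' · c'` (such a pair exists and is unique for the rectangles
in question; the value in the `else` branch is irrelevant). -/
noncomputable def combR {n a i r s : ℕ} (x : KR n a i × KR n r s) : KR n r s × KR n a i :=
  if h : ∃ y : KR n r s × KR n a i, tabMul x.2.rows x.1.rows = tabMul y.2.rows y.1.rows
  then h.choose else (x.2, x.1)

/-- The weight of a tableau as an element `∑ₐ (wt T)ₐ ϖₐ` of the weight lattice: the letter `j` has
weight `ϖ_j - ϖ_{j-1}` (with `ϖ_0 = ϖ_{n+1} = 0`), so the coefficient of `ϖ_j` is the number of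
letters `j` minus the number of letters `j + 1`. -/
def wt {n r s : ℕ} (T : KR n r s) (k : Fin n) : ℤ :=
  ((Finset.univ.filter fun p : Fin r × Fin s => T.1 p.1 p.2 = k.castSucc).card : ℤ)
    - ((Finset.univ.filter fun p : Fin r × Fin s => T.1 p.1 p.2 = k.succ).card : ℤ)

/-- `exp wt(T)`, written in the variables `z_k = e^{ϖ_k}`. -/
def expWt {K : Type*} [Field K] {n r s : ℕ} (z : Fin n → K) (T : KR n r s) : K :=
  ∏ k, z k ^ wt T k

/-- `Q^{(r)}_s`, the character of `B^{(r)}_s`. -/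
def charQ {K : Type*} [Field K] {n : ℕ} (z : Fin n → K) (r s : ℕ) : K :=
  ∑ T : KR n r s, expWt z T

/-- `π^{(r)}_s(T) = exp wt(T) / Q^{(r)}_s`. -/
def piMeas {K : Type*} [Field K] {n r s : ℕ} (z : Fin n → K) (T : KR n r s) : K :=
  expWt z T / charQ z r s

/-- The transition rate of the carrier,
`Rate(u → u') = ∑_{b, b' : R(u ⊗ b) = b' ⊗ u'} p(b)`, for i.i.d. local states with law `p`. -/
noncomputable def rate {K : Type*} [Field K] {n a i r s : ℕ} (p : KR n r s → K)
    (u u' : KR n a i) : K :=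
  ∑ bb ∈ Finset.univ.filter (fun bb : KR n r s × KR n r s => combR (u, bb.1) = (bb.2, u')), p bb.1

/-- The generators `z_1, …, z_n` of the field `ℝ(z_1, …, z_n)` of rational functions. -/
noncomputable def zGen (n : ℕ) (k : Fin n) : FractionRing (MvPolynomial (Fin n) ℝ) :=
  algebraMap (MvPolynomial (Fin n) ℝ) _ (MvPolynomial.X k)

end BoxBall

/-! Stationarity follows from two properties of `combR`: it is a bijection and it preserves total
weight. Hence it carries the product weight of `u ⊗ b` to that of `b' ⊗ u'`. Reindexing the
stationarity sum along it leaves `piMeas z u'` times the total mass of the local states, which is 1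
(`sum_piMeas_mul_rate`).

The substance is that a product `c · b` of rectangular tableaux can be rewritten as some `b' · c'`
in exactly one way. Words carry crystal operators `up k` and `down k`, and `CEquiv` is bisimilarity
for them. Elementary Knuth moves are bisimilar (`isBisim_knuth`), so row insertion stays within a
class, and each class contains only one tableau (`IsTab.eq_of_cEquiv`). Equality of products thus
becomes bisimilarity of concatenated row words (`tabMul_eq_iff`).

For uniqueness, raising reduces to highest weight words. There the right factor is forced, and the
left factor is a rectangle determined by its content (`PairWord.eq_of_isHW`); the tensor product of
two rectangles is therefore multiplicity free.

For existence (`PairWord.exists_cEquiv`), both orders of the factors give equally many words of each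
content. Induction on the sum of letters matches the words that are not of highest weight, and
counting then excludes an unmatched highest weight word. -/

namespace BoxBall

/-! ### Crystal structure on words. -/

/-- The number of unpaired letters `k` in a word, where a letter `k + 1` is paired with a letter
`k` to its right. -/
def phi (k : ℕ) (w : List ℕ) : ℕ :=
  w.foldr (fun x m => (if x = k then 1 else 0) + (m - (if x = k + 1 then 1 else 0))) 0

/-- The number of unpaired letters `k + 1` in a word. -/
def eps (k : ℕ) : List ℕ → ℕ
  | [] => 0
  | x :: v => eps k v + ((if x = k + 1 then 1 else 0) - phi k v)

@[simp] theorem phi_nil (k : ℕ) : phi k [] = 0 := rfl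

theorem phi_cons (k x : ℕ) (v : List ℕ) :
    phi k (x :: v) = (if x = k then 1 else 0) + (phi k v - (if x = k + 1 then 1 else 0)) := rfl

@[simp] theorem eps_nil (k : ℕ) : eps k [] = 0 := rfl

theorem eps_cons (k x : ℕ) (v : List ℕ) :
    eps k (x :: v) = eps k v + ((if x = k + 1 then 1 else 0) - phi k v) := rfl

/-- The raising crystal operator: the leftmost unpaired `k + 1` becomes `k`. -/
def up (k : ℕ) : List ℕ → Option (List ℕ)
  | [] => none
  | x :: v => if x = k + 1 ∧ phi k v = 0 then some (k :: v) else (up k v).map (x :: ·)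

/-- The lowering crystal operator: the rightmost unpaired `k` becomes `k + 1`. -/
def down (k : ℕ) : List ℕ → Option (List ℕ)
  | [] => none
  | x :: v => if (if x = k + 1 then 1 else 0) < phi k v then (down k v).map (x :: ·)
      else if x = k then some ((k + 1) :: v) else none

/-- In a concatenation the unpaired `k + 1` of `u` are matched against the unpaired `k` of `v`; the
truncated subtraction counts what survives. -/
theorem phi_append (k : ℕ) (u v : List ℕ) :
    phi k (u ++ v) = phi k u + (phi k v - eps k u) := by
  induction u with
  | nil => simp
  | cons x u ih =>
    simp only [List.cons_append, phi_cons, eps_cons, ih]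
    split_ifs <;> omega

theorem eps_append (k : ℕ) (u v : List ℕ) :
    eps k (u ++ v) = eps k v + (eps k u - phi k v) := by
  induction u with
  | nil => simp
  | cons x u ih =>
    simp only [List.cons_append, phi_append, eps_cons, ih]
    split_ifs <;> omega

/-- The tensor product rule: the numbers of unpaired letters alone decide which factor is acted on.
This makes bisimilarity a congruence for concatenation. -/
theorem up_append (k : ℕ) (u v : List ℕ) :
    up k (u ++ v) = if phi k v < eps k u then (up k u).map (· ++ v)
      else (up k v).map (u ++ ·) := by
  induction u with
  | nil => simp
  | cons x u ih =>
    simp only [List.cons_append, up, phi_append, eps_cons, ih]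
    by_cases h1 : x = k + 1
    · by_cases h2 : phi k u = 0
      · by_cases h3 : phi k v < eps k u + 1
        · simp [h1, h2, h3, show phi k v - eps k u = 0 by omega]
        · simp [h1, h2, h3, show ¬ (phi k v - eps k u = 0) by omega,
            show ¬ phi k v < eps k u by omega, Function.comp_def]
      · have h3 : ¬ (phi k u + (phi k v - eps k u) = 0) := by omega
        simp only [h1, h2, h3, and_false, if_false, if_true, show 1 - phi k u = 0 by omega,
          Nat.add_zero]
        split_ifs <;> simp [Function.comp_def]
    · simp only [h1, false_and, if_false]
      split_ifs <;> first | omega | simp [Function.comp_def]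

theorem down_append (k : ℕ) (u v : List ℕ) :
    down k (u ++ v) = if eps k u < phi k v then (down k v).map (u ++ ·)
      else (down k u).map (· ++ v) := by
  induction u with
  | nil =>
    have : ∀ v, phi k v = 0 → down k v = none := by
      intro v
      induction v with
      | nil => simp [down]
      | cons x v ih =>
        intro h
        simp only [phi_cons] at h
        split_ifs at h <;> simp_all [down]
        omega
    by_cases h : phi k v = 0
    · simp [h, down, this v h]
    · simp [show 0 < phi k v by omega]
  | cons x u ih =>
    simp only [List.cons_append, down, phi_append, eps_cons, ih]
    by_cases h1 : x = k + 1
    · simp only [h1, if_true]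
      split_ifs <;> first | omega | simp [Function.comp_def]
    · simp only [h1, if_false]
      split_ifs <;> first | omega | simp [Function.comp_def]

theorem up_eq_none_iff (k : ℕ) (w : List ℕ) : up k w = none ↔ eps k w = 0 := by
  induction w with
  | nil => simp [up]
  | cons x v ih =>
    simp only [up, eps_cons]
    by_cases h : x = k + 1 <;> by_cases h' : phi k v = 0 <;> simp [h, h', ih]
    omega

theorem eps_phi_of_up {k : ℕ} {w w' : List ℕ} (h : up k w = some w') :
    eps k w = eps k w' + 1 ∧ phi k w' = phi k w + 1 := by
  induction w generalizing w' with
  | nil => simp [up] at h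
  | cons x v ih =>
    simp only [up] at h
    split_ifs at h with h1
    · obtain ⟨rfl, h2⟩ := h1
      cases h
      simp [eps_cons, phi_cons, h2]
    · obtain ⟨v', hv, rfl⟩ := Option.map_eq_some_iff.1 h
      obtain ⟨h3, h4⟩ := ih hv
      simp only [eps_cons, phi_cons]
      split_ifs <;> simp_all <;> omega

theorem eps_phi_of_down {k : ℕ} {w w' : List ℕ} (h : down k w = some w') :
    eps k w' = eps k w + 1 ∧ phi k w = phi k w' + 1 := by
  induction w generalizing w' with
  | nil => simp [down] at h
  | cons x v ih =>
    simp only [down] at h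
    by_cases h1 : (if x = k + 1 then 1 else 0) < phi k v
    · rw [if_pos h1] at h
      obtain ⟨v', hv, rfl⟩ := Option.map_eq_some_iff.1 h
      obtain ⟨h3, h4⟩ := ih hv
      simp only [eps_cons, phi_cons]
      split_ifs at * <;> omega
    · rw [if_neg h1] at h
      split_ifs at h with h2
      subst h2
      cases h
      simp [eps_cons, phi_cons] at h1 ⊢
      omega

/-- Used to bring back to `w` what an induction has established for the raised word. -/
theorem down_of_up {k : ℕ} {w w' : List ℕ} (h : up k w = some w') : down k w' = some w := by
  induction w generalizing w' with
  | nil => simp [up] at h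
  | cons x v ih =>
    simp only [up] at h
    split_ifs at h with h1
    · obtain ⟨rfl, h2⟩ := h1
      cases h
      simp [down, h2]
    · obtain ⟨v', hv, rfl⟩ := Option.map_eq_some_iff.1 h
      have := (eps_phi_of_up hv).2
      simp only [down, ih hv]
      rw [if_pos]
      · rfl
      · split_ifs with h2
        · have : phi k v ≠ 0 := fun h3 => h1 ⟨h2, h3⟩
          omega
        · omega

theorem up_of_down {k : ℕ} {w w' : List ℕ} (h : down k w = some w') : up k w' = some w := by
  induction w generalizing w' with
  | nil => simp [down] at h
  | cons x v ih =>
    simp only [down] at h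
    by_cases h1 : (if x = k + 1 then 1 else 0) < phi k v
    · rw [if_pos h1] at h
      obtain ⟨v', hv, rfl⟩ := Option.map_eq_some_iff.1 h
      have := (eps_phi_of_down hv).2
      simp only [up, ih hv]
      rw [if_neg]
      · rfl
      · rintro ⟨rfl, h2⟩
        simp at h1
        omega
    · rw [if_neg h1] at h
      split_ifs at h with h2
      subst h2
      cases h
      simp at h1
      simp [up, h1]

theorem phi_add_count (k : ℕ) (w : List ℕ) :
    phi k w + w.count (k + 1) = eps k w + w.count k := by
  induction w with
  | nil => simp
  | cons x v ih =>
    simp only [phi_cons, eps_cons, List.count_cons, beq_iff_eq]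
    split_ifs <;> omega

theorem phi_le_count (k : ℕ) (w : List ℕ) : phi k w ≤ w.count k := by
  induction w with
  | nil => simp
  | cons x v ih =>
    simp only [phi_cons, List.count_cons, beq_iff_eq]
    split_ifs <;> omega

/-- The sum of the letters is the measure for every induction towards highest weight. -/
theorem sum_of_up {k : ℕ} {w w' : List ℕ} (h : up k w = some w') : w.sum = w'.sum + 1 := by
  induction w generalizing w' with
  | nil => simp [up] at h
  | cons x v ih =>
    simp only [up] at h
    split_ifs at h with h1
    · cases h; simp [h1.1]; omega
    · obtain ⟨v', hv, rfl⟩ := Option.map_eq_some_iff.1 h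
      simp [ih hv]; omega

theorem length_of_up {k : ℕ} {w w' : List ℕ} (h : up k w = some w') : w'.length = w.length := by
  induction w generalizing w' with
  | nil => simp [up] at h
  | cons x v ih =>
    simp only [up] at h
    split_ifs at h with h1
    · cases h; simp
    · obtain ⟨v', hv, rfl⟩ := Option.map_eq_some_iff.1 h
      simp [ih hv]

/-! ### Bisimilarity of words. -/

/-- A relation on words that is compatible with the crystal structure. -/
def IsBisim (r : List ℕ → List ℕ → Prop) : Prop :=
  ∀ u v, r u v → u.Perm v ∧ ∀ k, eps k u = eps k v ∧ phi k u = phi k v ∧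
    Option.Rel r (up k u) (up k v) ∧ Option.Rel r (down k u) (down k v)

/-- Equivalence of words: they occupy the same place in isomorphic crystals. -/
def CEquiv (u v : List ℕ) : Prop := ∃ r, IsBisim r ∧ r u v

theorem option_rel_mono {α β : Type*} {r r' : α → β → Prop} (h : ∀ a b, r a b → r' a b) :
    ∀ {x : Option α} {y : Option β}, Option.Rel r x y → Option.Rel r' x y
  | _, _, .none => .none
  | _, _, .some hab => .some (h _ _ hab)

theorem option_rel_map {α β α' β' : Type*} {r : α → β → Prop} {r' : α' → β' → Prop}
    {f : α → α'} {g : β → β'} (h : ∀ a b, r a b → r' (f a) (g b)) :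
    ∀ {x : Option α} {y : Option β}, Option.Rel r x y → Option.Rel r' (x.map f) (y.map g)
  | _, _, .none => .none
  | _, _, .some hab => .some (h _ _ hab)

theorem option_rel_flip {α β : Type*} {r : α → β → Prop} :
    ∀ {x : Option α} {y : Option β}, Option.Rel r x y → Option.Rel (fun b a => r a b) y x
  | _, _, .none => .none
  | _, _, .some hab => .some hab

theorem option_rel_comp {α β γ : Type*} {r : α → β → Prop} {r' : β → γ → Prop} :
    ∀ {x : Option α} {y : Option β} {z : Option γ}, Option.Rel r x y → Option.Rel r' y z →
      Option.Rel (fun a c => ∃ b, r a b ∧ r' b c) x z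
  | _, _, _, .none, .none => .none
  | _, _, _, .some hab, .some hbc => .some ⟨_, hab, hbc⟩

theorem option_rel_refl {α : Type*} {r : α → α → Prop} (h : ∀ a, r a a) :
    ∀ x : Option α, Option.Rel r x x
  | none => .none
  | some _ => .some (h _)

theorem isBisim_cEquiv : IsBisim CEquiv := by
  rintro u v ⟨r, hr, huv⟩
  obtain ⟨h0, h⟩ := hr u v huv
  refine ⟨h0, fun k => ⟨(h k).1, (h k).2.1, ?_, ?_⟩⟩
  · exact option_rel_mono (fun a b hab => ⟨r, hr, hab⟩) (h k).2.2.1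
  · exact option_rel_mono (fun a b hab => ⟨r, hr, hab⟩) (h k).2.2.2

theorem CEquiv.refl (u : List ℕ) : CEquiv u u :=
  ⟨Eq, by
    rintro u v rfl
    exact ⟨.refl _, fun k => ⟨rfl, rfl, option_rel_refl (fun _ => rfl) _,
      option_rel_refl (fun _ => rfl) _⟩⟩, rfl⟩

theorem CEquiv.symm {u v : List ℕ} (h : CEquiv u v) : CEquiv v u := by
  refine ⟨fun a b => CEquiv b a, ?_, h⟩
  intro a b hab
  obtain ⟨h0, h⟩ := isBisim_cEquiv _ _ hab
  exact ⟨h0.symm, fun k => ⟨(h k).1.symm, (h k).2.1.symm, option_rel_flip (h k).2.2.1,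
    option_rel_flip (h k).2.2.2⟩⟩

theorem CEquiv.trans {u v w : List ℕ} (h : CEquiv u v) (h' : CEquiv v w) : CEquiv u w := by
  refine ⟨fun a c => ∃ b, CEquiv a b ∧ CEquiv b c, ?_, v, h, h'⟩
  rintro a c ⟨b, hab, hbc⟩
  obtain ⟨h0, h⟩ := isBisim_cEquiv _ _ hab
  obtain ⟨h0', h'⟩ := isBisim_cEquiv _ _ hbc
  exact ⟨h0.trans h0', fun k => ⟨(h k).1.trans (h' k).1, (h k).2.1.trans (h' k).2.1,
    option_rel_comp (h k).2.2.1 (h' k).2.2.1, option_rel_comp (h k).2.2.2 (h' k).2.2.2⟩⟩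

theorem CEquiv.append {u u' v v' : List ℕ} (h : CEquiv u u') (h' : CEquiv v v') :
    CEquiv (u ++ v) (u' ++ v') := by
  refine ⟨fun a b => ∃ u u' v v', CEquiv u u' ∧ CEquiv v v' ∧ a = u ++ v ∧ b = u' ++ v', ?_,
    u, u', v, v', h, h', rfl, rfl⟩
  rintro _ _ ⟨u, u', v, v', hu, hv, rfl, rfl⟩
  obtain ⟨h0, h⟩ := isBisim_cEquiv _ _ hu
  obtain ⟨h0', h'⟩ := isBisim_cEquiv _ _ hv
  refine ⟨h0.append h0', fun k => ?_⟩
  obtain ⟨h1, h2, h3, h4⟩ := h k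
  obtain ⟨h1', h2', h3', h4'⟩ := h' k
  refine ⟨by rw [eps_append, eps_append, h1, h1', h2'], by rw [phi_append, phi_append, h1, h2, h2'],
    ?_, ?_⟩
  · rw [up_append, up_append, h1, h2']
    split_ifs
    · exact option_rel_map (fun a b hab => ⟨a, b, v, v', hab, hv, rfl, rfl⟩) h3
    · exact option_rel_map (fun a b hab => ⟨u, u', a, b, hu, hab, rfl, rfl⟩) h3'
  · rw [down_append, down_append, h1, h2']
    split_ifs
    · exact option_rel_map (fun a b hab => ⟨u, u', a, b, hu, hab, rfl, rfl⟩) h4'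
    · exact option_rel_map (fun a b hab => ⟨a, b, v, v', hab, hv, rfl, rfl⟩) h4

theorem CEquiv.exists_up {k : ℕ} {u v u' : List ℕ} (h : CEquiv u v) (hu : up k u = some u') :
    ∃ v', up k v = some v' ∧ CEquiv u' v' := by
  have := ((isBisim_cEquiv _ _ h).2 k).2.2.1
  rw [hu] at this
  cases hv : up k v with
  | none => rw [hv] at this; cases this
  | some v' => rw [hv] at this; cases this with | some h => exact ⟨v', rfl, h⟩

theorem CEquiv.exists_down {k : ℕ} {u v u' : List ℕ} (h : CEquiv u v)
    (hu : down k u = some u') : ∃ v', down k v = some v' ∧ CEquiv u' v' := by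
  have := ((isBisim_cEquiv _ _ h).2 k).2.2.2
  rw [hu] at this
  cases hv : down k v with
  | none => rw [hv] at this; cases this
  | some v' => rw [hv] at this; cases this with | some h => exact ⟨v', rfl, h⟩

theorem CEquiv.perm {u v : List ℕ} (h : CEquiv u v) : u.Perm v := (isBisim_cEquiv _ _ h).1

theorem CEquiv.eps_eq {u v : List ℕ} (h : CEquiv u v) (k : ℕ) : eps k u = eps k v :=
  ((isBisim_cEquiv _ _ h).2 k).1

/-! ### Knuth relations and row bumping. -/

/-- The elementary Knuth transformations. -/
inductive Knuth : List ℕ → List ℕ → Prop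
  | left (x y z : ℕ) (hxy : x < y) (hyz : y ≤ z) : Knuth [y, z, x] [y, x, z]
  | right (x y z : ℕ) (hxy : x ≤ y) (hyz : y < z) : Knuth [x, z, y] [z, x, y]

theorem Knuth.of_left {x y z : ℕ} (h : x < y ∧ y ≤ z) : Knuth [y, z, x] [y, x, z] :=
  .left x y z h.1 h.2

theorem Knuth.of_right {x y z : ℕ} (h : x ≤ y ∧ y < z) : Knuth [x, z, y] [z, x, y] :=
  .right x y z h.1 h.2

-- Only the positions of the three letters relative to `k` and `k + 1` matter, so the check is
-- finite. The two kinds of move must be taken together: raising `(k+1)(k+1)k` and `(k+1)k(k+1)`, a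
-- pair of the first kind, gives `k(k+1)k` and `(k+1)kk`, a pair of the second.
set_option maxHeartbeats 2000000 in
theorem isBisim_knuth : IsBisim Knuth := by
  intro u v h
  rcases h with ⟨x, y, z, hxy, hyz⟩ | ⟨x, y, z, hxy, hyz⟩
  · refine ⟨(List.Perm.swap _ _ _).cons _, fun k => ⟨?_, ?_, ?_, ?_⟩⟩
    · simp only [eps_cons, phi_cons, phi_nil, eps_nil]
      split_ifs <;> omega
    · simp only [phi_cons, phi_nil]
      split_ifs <;> omega
    all_goals
      by_cases hx : x = k <;> by_cases hx' : x = k + 1 <;> by_cases hy : y = k <;>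
      by_cases hy' : y = k + 1 <;> by_cases hz : z = k <;> by_cases hz' : z = k + 1 <;>
      first
      | omega
      | (simp [up, down, phi_cons, hx, hx', hy, hy', hz, hz']; done)
      | (simp [up, down, phi_cons, hx, hx', hy, hy', hz, hz']
         first
         | exact .none
         | exact .of_left (by omega)
         | exact .of_right (by omega))
  · refine ⟨List.Perm.swap _ _ _, fun k => ⟨?_, ?_, ?_, ?_⟩⟩
    · simp only [eps_cons, phi_cons, phi_nil, eps_nil]
      split_ifs <;> omega
    · simp only [phi_cons, phi_nil]
      split_ifs <;> omega
    all_goals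
      by_cases hx : x = k <;> by_cases hx' : x = k + 1 <;> by_cases hy : y = k <;>
      by_cases hy' : y = k + 1 <;> by_cases hz : z = k <;> by_cases hz' : z = k + 1 <;>
      first
      | omega
      | (simp [up, down, phi_cons, hx, hx', hy, hy', hz, hz']; done)
      | (simp [up, down, phi_cons, hx, hx', hy, hy', hz, hz']
         first
         | exact .none
         | exact .of_left (by omega)
         | exact .of_right (by omega))

theorem Knuth.cEquiv {u v : List ℕ} (h : Knuth u v) : CEquiv u v := ⟨Knuth, isBisim_knuth, h⟩

theorem CEquiv.cons {u v : List ℕ} (x : ℕ) (h : CEquiv u v) : CEquiv (x :: u) (x :: v) :=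
  (CEquiv.refl [x]).append h

/-- First half of a bump: the small letter `x` travels left through `R` by Knuth moves until it
stands just behind `z`. -/
theorem cEquiv_slide {x z : ℕ} {R : List ℕ} (hx : x < z) (hR : (z :: R).Pairwise (· ≤ ·)) :
    CEquiv (z :: R ++ [x]) (z :: x :: R) := by
  induction R generalizing z with
  | nil => exact .refl _
  | cons w R ih =>
    rw [List.pairwise_cons] at hR
    have hzw : z ≤ w := hR.1 w (by simp)
    have h1 : CEquiv (z :: (w :: R ++ [x])) (z :: w :: x :: R) := (ih (by omega) hR.2).cons z
    exact h1.trans ((Knuth.left x z w hx hzw).cEquiv.append (.refl R))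

theorem bumpRow_none {x : ℕ} {R : List ℕ} (h : (bumpRow x R).2 = none) :
    (bumpRow x R).1 = R ++ [x] := by
  induction R with
  | nil => rfl
  | cons z R ih =>
    simp only [bumpRow] at h ⊢
    split_ifs at h ⊢ with h1
    simp [ih h]

theorem lt_of_bumpRow_some {x y : ℕ} {R : List ℕ} (h : (bumpRow x R).2 = some y) : x < y := by
  induction R with
  | nil => simp [bumpRow] at h
  | cons z R ih =>
    simp only [bumpRow] at h
    split_ifs at h with h1
    · cases h; exact h1
    · exact ih h

theorem mem_bumpRow {x y : ℕ} {R : List ℕ} (h : y ∈ (bumpRow x R).1) : y = x ∨ y ∈ R := by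
  induction R with
  | nil => simpa [bumpRow] using h
  | cons z R ih =>
    simp only [bumpRow] at h
    split_ifs at h with h1
    · simp at h ⊢; tauto
    · simp at h ⊢; tauto

theorem pairwise_bumpRow (x : ℕ) {R : List ℕ} (hR : R.Pairwise (· ≤ ·)) :
    (bumpRow x R).1.Pairwise (· ≤ ·) := by
  induction R with
  | nil => simp [bumpRow]
  | cons z R ih =>
    rw [List.pairwise_cons] at hR
    simp only [bumpRow]
    split_ifs with h1
    · refine List.pairwise_cons.2 ⟨fun y hy => h1.le.trans (hR.1 y hy), hR.2⟩
    · refine List.pairwise_cons.2 ⟨fun y hy => ?_, ih hR.2⟩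
      rcases mem_bumpRow hy with rfl | hy
      · omega
      · exact hR.1 y hy

theorem bumpRow_ne_nil (x : ℕ) (R : List ℕ) : (bumpRow x R).1 ≠ [] := by
  cases R <;> simp [bumpRow]
  split_ifs <;> simp

/-- Once `x` stands behind the letter `y` it bumps, `y` travels left to the front past the letters
`≤ x`, by Knuth moves of the second kind. -/
theorem cEquiv_bumpRow {x y : ℕ} {R : List ℕ} (hR : R.Pairwise (· ≤ ·))
    (h : (bumpRow x R).2 = some y) : CEquiv (R ++ [x]) (y :: (bumpRow x R).1) := by
  induction R with
  | nil => simp [bumpRow] at h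
  | cons z R ih =>
    have hR' := List.pairwise_cons.1 hR
    simp only [bumpRow] at h ⊢
    split_ifs at h ⊢ with h1
    · cases h
      exact cEquiv_slide h1 hR
    · have h2 : CEquiv (z :: (R ++ [x])) (z :: y :: (bumpRow x R).1) := (ih hR'.2 h).cons z
      refine h2.trans ?_
      cases R with
      | nil => simp [bumpRow] at h
      | cons z' R =>
        simp only [bumpRow] at h ⊢
        have hz : z ≤ z' := hR'.1 z' (by simp)
        split_ifs at h ⊢ with h3
        · cases h
          exact (Knuth.right z x y (by omega) h3).cEquiv.append (.refl R)
        · have := lt_of_bumpRow_some h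
          exact (Knuth.right z z' y (by omega) (by omega)).cEquiv.append (.refl _)

/-! ### Tableaux under row insertion. -/

/-- `Over R S`: the row `S` can stand below the row `R` in a tableau. -/
def Over : List ℕ → List ℕ → Prop
  | _, [] => True
  | [], _ :: _ => False
  | a :: R, b :: S => a < b ∧ Over R S

@[simp] theorem over_nil_right (R : List ℕ) : Over R [] := by cases R <;> trivial

/-- Semistandard tableaux without empty rows, given by their rows from top to bottom. -/
def IsTab : List (List ℕ) → Prop
  | [] => True
  | R :: T => R.Pairwise (· ≤ ·) ∧ R ≠ [] ∧ Over R (T.headD []) ∧ IsTab T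

theorem rowWord_cons {α : Type*} (R : List α) (T : List (List α)) :
    rowWord (R :: T) = rowWord T ++ R := by simp [rowWord]

@[simp] theorem rowWord_nil {α : Type*} : rowWord ([] : List (List α)) = [] := rfl

theorem over_append {R S U : List ℕ} (h : Over R S) : Over (R ++ U) S := by
  induction R generalizing S with
  | nil => cases S <;> simp_all [Over]
  | cons a R ih =>
    cases S with
    | nil => trivial
    | cons b S => exact ⟨h.1, ih h.2⟩

theorem over_bumpRow_left {x y : ℕ} {R S : List ℕ} (h : (bumpRow x R).2 = some y)
    (hRS : Over R S) : Over (bumpRow x R).1 S := by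
  induction R generalizing S with
  | nil => simp [bumpRow] at h
  | cons a R ih =>
    cases S with
    | nil => simp
    | cons b S =>
      simp only [bumpRow] at h ⊢
      split_ifs at h ⊢ with h1
      · exact ⟨h1.trans hRS.1, hRS.2⟩
      · exact ⟨hRS.1, ih h hRS.2⟩

/-- The entry below the place that `y` leaves, if any, exceeds `y`, so `y` enters the next row in
that column or further left, where the letters now above are smaller than `y`. -/
theorem over_bumpRow {x y : ℕ} {R S : List ℕ} (h : (bumpRow x R).2 = some y)
    (hR : R.Pairwise (· ≤ ·)) (hRS : Over R S) : Over (bumpRow x R).1 (bumpRow y S).1 := by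
  induction R generalizing S with
  | nil => simp [bumpRow] at h
  | cons a R ih =>
    have hR' := List.pairwise_cons.1 hR
    simp only [bumpRow] at h ⊢
    split_ifs at h ⊢ with h1
    · cases h
      cases S with
      | nil => exact ⟨h1, by simp⟩
      | cons b S =>
        simp only [bumpRow, if_pos hRS.1]
        exact ⟨h1, hRS.2⟩
    · have hy := lt_of_bumpRow_some h
      cases S with
      | nil => exact ⟨by omega, by simp⟩
      | cons b S =>
        simp only [bumpRow]
        split_ifs with h2
        · exact ⟨by omega, over_bumpRow_left h hRS.2⟩
        · exact ⟨hRS.1, ih h hR'.2 hRS.2⟩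

theorem rowInsert_cons_none {x : ℕ} {R : List ℕ} {T : List (List ℕ)}
    (h : (bumpRow x R).2 = none) : rowInsert (R :: T) x = (R ++ [x]) :: T := by
  simp only [rowInsert, h, bumpRow_none h]

theorem rowInsert_cons_some {x y : ℕ} {R : List ℕ} {T : List (List ℕ)}
    (h : (bumpRow x R).2 = some y) :
    rowInsert (R :: T) x = (bumpRow x R).1 :: rowInsert T y := by
  simp only [rowInsert, h]

theorem headD_rowInsert (T : List (List ℕ)) (x : ℕ) :
    (rowInsert T x).headD [] = (bumpRow x (T.headD [])).1 := by
  cases T with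
  | nil => rfl
  | cons R T =>
    cases h : (bumpRow x R).2 with
    | none => rw [rowInsert_cons_none h]; simp [bumpRow_none h]
    | some y => rw [rowInsert_cons_some h]; simp

theorem IsTab.rowInsert {T : List (List ℕ)} (hT : IsTab T) (x : ℕ) : IsTab (rowInsert T x) := by
  induction T generalizing x with
  | nil => simp [BoxBall.rowInsert, IsTab]
  | cons R T ih =>
    obtain ⟨h1, h2, h3, h4⟩ := hT
    cases h : (bumpRow x R).2 with
    | none =>
      rw [rowInsert_cons_none h]
      refine ⟨?_, by simp, over_append h3, h4⟩
      rw [← bumpRow_none h]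
      exact pairwise_bumpRow x h1
    | some y =>
      rw [rowInsert_cons_some h]
      refine ⟨pairwise_bumpRow x h1, bumpRow_ne_nil _ _, ?_, ih h4 y⟩
      rw [headD_rowInsert]
      exact over_bumpRow h h1 h3

theorem cEquiv_rowInsert {T : List (List ℕ)} (hT : IsTab T) (x : ℕ) :
    CEquiv (rowWord T ++ [x]) (rowWord (rowInsert T x)) := by
  induction T generalizing x with
  | nil => exact .refl _
  | cons R T ih =>
    obtain ⟨h1, -, -, h4⟩ := hT
    cases h : (bumpRow x R).2 with
    | none =>
      rw [rowInsert_cons_none h, rowWord_cons, rowWord_cons, List.append_assoc]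
      exact .refl _
    | some y =>
      rw [rowInsert_cons_some h, rowWord_cons, rowWord_cons, List.append_assoc]
      have := ((CEquiv.refl (rowWord T)).append (cEquiv_bumpRow h1 h)).trans
        (by simpa using (ih h4 y).append (.refl (bumpRow x R).1))
      exact this

theorem tabMul_aux (w : List ℕ) {T : List (List ℕ)} (hT : IsTab T) :
    IsTab (w.foldl rowInsert T) ∧ CEquiv (rowWord T ++ w) (rowWord (w.foldl rowInsert T)) := by
  induction w generalizing T with
  | nil => simpa using ⟨hT, .refl _⟩
  | cons x w ih =>
    obtain ⟨h1, h2⟩ := ih (hT.rowInsert x)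
    refine ⟨h1, ?_⟩
    have := ((cEquiv_rowInsert hT x).append (.refl w)).trans h2
    simpa using this

theorem IsTab.tabMul {S : List (List ℕ)} (hS : IsTab S) (T : List (List ℕ)) :
    IsTab (tabMul S T) := (tabMul_aux _ hS).1

theorem cEquiv_tabMul {S : List (List ℕ)} (hS : IsTab S) (T : List (List ℕ)) :
    CEquiv (rowWord S ++ rowWord T) (rowWord (BoxBall.tabMul S T)) := (tabMul_aux _ hS).2

/-! ### Crystal operators on tableaux -/

theorem phi_of_pairwise (k : ℕ) {R : List ℕ} (hR : R.Pairwise (· ≤ ·)) : phi k R = R.count k := by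
  induction R with
  | nil => rfl
  | cons a R ih =>
    rw [List.pairwise_cons] at hR
    simp only [phi_cons, ih hR.2, List.count_cons, beq_iff_eq]
    by_cases h : a = k + 1
    · have : R.count k = 0 := List.count_eq_zero.2 fun hk => by have := hR.1 k hk; omega
      simp [h, this]
    · simp [h]; omega

theorem eps_of_pairwise (k : ℕ) {R : List ℕ} (hR : R.Pairwise (· ≤ ·)) :
    eps k R = R.count (k + 1) := by
  have := phi_add_count k R
  rw [phi_of_pairwise k hR] at this
  omega

/-- Entrywise comparison of rows of equal length. -/
abbrev RowLE : List ℕ → List ℕ → Prop := List.Forall₂ (· ≤ ·)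

theorem rowLE_refl (R : List ℕ) : RowLE R R := List.forall₂_refl _

theorem over_mono {R R' S S' : List ℕ} (h : Over R S) (hR : RowLE R' R) (hS : RowLE S S') :
    Over R' S' := by
  induction hR generalizing S S' with
  | nil => cases hS with
    | nil => trivial
    | cons _ _ => exact h.elim
  | cons hab _ ih => cases hS with
    | nil => trivial
    | cons hcd hS => exact ⟨by have := h.1; omega, ih h.2 hS⟩

theorem rowLE_of_up {k : ℕ} {w w' : List ℕ} (h : up k w = some w') : RowLE w' w := by
  induction w generalizing w' with
  | nil => simp [up] at h
  | cons x v ih =>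
    simp only [up] at h
    split_ifs at h with h1
    · cases h; exact .cons (by omega) (rowLE_refl _)
    · obtain ⟨v', hv, rfl⟩ := Option.map_eq_some_iff.1 h
      exact .cons le_rfl (ih hv)

theorem rowLE_of_down {k : ℕ} {w w' : List ℕ} (h : down k w = some w') : RowLE w w' :=
  rowLE_of_up (up_of_down h)

theorem mem_of_up {k x : ℕ} {w w' : List ℕ} (h : up k w = some w') (hx : x ∈ w') :
    x ∈ w ∨ x = k ∧ k + 1 ∈ w := by
  induction w generalizing w' with
  | nil => simp [up] at h
  | cons y v ih =>
    simp only [up] at h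
    split_ifs at h with h1
    · cases h
      simp at hx ⊢
      have := h1.1
      tauto
    · obtain ⟨v', hv, rfl⟩ := Option.map_eq_some_iff.1 h
      have := @ih _ hv
      simp at hx ⊢
      tauto

theorem pairwise_of_up {k : ℕ} {R R' : List ℕ} (h : up k R = some R')
    (hR : R.Pairwise (· ≤ ·)) : R'.Pairwise (· ≤ ·) := by
  induction R generalizing R' with
  | nil => simp [up] at h
  | cons x R ih =>
    rw [List.pairwise_cons] at hR
    simp only [up] at h
    split_ifs at h with h1
    · cases h
      exact List.pairwise_cons.2 ⟨fun y hy => by have := hR.1 y hy; omega, hR.2⟩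
    · obtain ⟨v', hv, rfl⟩ := Option.map_eq_some_iff.1 h
      refine List.pairwise_cons.2 ⟨fun y hy => ?_, ih hv hR.2⟩
      rcases mem_of_up hv hy with hy | ⟨rfl, hy⟩
      · exact hR.1 y hy
      · have h3 := hR.1 _ hy
        have h4 : phi y R ≠ 0 ∨ x ≠ y + 1 := by tauto
        rcases h4 with h4 | h4
        · have := phi_le_count y R
          exact hR.1 y (List.count_pos_iff.1 (by omega))
        · omega

theorem pairwise_of_down {k : ℕ} {R R' : List ℕ} (h : down k R = some R')
    (hR : R.Pairwise (· ≤ ·)) : R'.Pairwise (· ≤ ·) := by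
  induction R generalizing R' with
  | nil => simp [down] at h
  | cons x R ih =>
    rw [List.pairwise_cons] at hR
    simp only [down] at h
    by_cases h1 : (if x = k + 1 then 1 else 0) < phi k R
    · rw [if_pos h1] at h
      obtain ⟨v', hv, rfl⟩ := Option.map_eq_some_iff.1 h
      refine List.pairwise_cons.2 ⟨fun y hy => ?_, ih hv hR.2⟩
      clear ih h h1
      have := rowLE_of_down hv
      clear hv
      induction this with
      | nil => simp at hy
      | cons hab _ ih =>
        rcases List.mem_cons.1 hy with rfl | hy
        · exact (hR.1 _ (by simp)).trans hab
        · exact ih ⟨fun z hz => hR.1 z (by simp [hz]), (List.pairwise_cons.1 hR.2).2⟩ hy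
    · rw [if_neg h1] at h
      split_ifs at h with h2
      subst h2
      cases h
      simp [phi_of_pairwise _ hR.2] at h1
      refine List.pairwise_cons.2 ⟨fun y hy => ?_, hR.2⟩
      have := hR.1 y hy
      have : y ≠ x := by rintro rfl; exact h1 hy
      omega

theorem count_le_count_of_over {k : ℕ} {R S : List ℕ} (h : Over R S) (hR : ∀ x ∈ R, k ≤ x) :
    S.count (k + 1) ≤ R.count k := by
  induction R generalizing S with
  | nil => cases S <;> simp_all [Over]
  | cons a R ih =>
    cases S with
    | nil => simp
    | cons b S =>
      have h1 := ih h.2 fun x hx => hR x (by simp [hx])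
      have h2 := hR a (by simp)
      have h3 := h.1
      simp only [List.count_cons, beq_iff_eq]
      split_ifs <;> omega

/-- The leftmost `k + 1` of `S` changes, which is harmful only below a `k`. In that case every `k +
1` of `S` would lie below a `k` of `R`, against `hlt`. -/
theorem over_of_up_right {k : ℕ} {R S S' : List ℕ} (hR : R.Pairwise (· ≤ ·))
    (hS : S.Pairwise (· ≤ ·)) (h : Over R S) (hS' : up k S = some S')
    (hlt : R.count k < S.count (k + 1)) : Over R S' := by
  induction S generalizing R S' with
  | nil => simp [up] at hS'
  | cons b S ih =>
    cases R with
    | nil => exact h.elim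
    | cons a R =>
      obtain ⟨hab, hRS⟩ := h
      have hR' := List.pairwise_cons.1 hR
      have hS2 := List.pairwise_cons.1 hS
      simp only [up] at hS'
      by_cases hb : b = k + 1
      · have hak : a ≠ k := by
          rintro rfl
          have := count_le_count_of_over (k := a) (R := a :: R) (S := b :: S) ⟨hab, hRS⟩
            (by simpa using hR'.1)
          omega
        split_ifs at hS' with h1
        · cases hS'
          exact ⟨by omega, hRS⟩
        · have : S.count k = 0 := List.count_eq_zero.2 fun hk => by have := hS2.1 k hk; omega
          rw [phi_of_pairwise _ hS2.2] at h1
          exact absurd ⟨hb, this⟩ h1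
      · simp only [hb, false_and, if_false] at hS'
        obtain ⟨v', hv, rfl⟩ := Option.map_eq_some_iff.1 hS'
        refine ⟨hab, ih hR'.2 hS2.2 hRS hv ?_⟩
        simp only [List.count_cons, beq_iff_eq, hb, if_false] at hlt
        omega

/-- The rightmost `k` of `R` changes, which is harmful only above a `k + 1`. In that case every `k`
of `R` would lie above a `k + 1` of `S`, against `hlt`. -/
theorem over_of_down_left {k : ℕ} {R R' S : List ℕ} (hR : R.Pairwise (· ≤ ·))
    (hS : S.Pairwise (· ≤ ·)) (h : Over R S) (hR' : down k R = some R')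
    (hlt : S.count (k + 1) < R.count k) : Over R' S := by
  induction R generalizing S R' with
  | nil => simp [down] at hR'
  | cons a R ih =>
    cases S with
    | nil => simp
    | cons b S =>
      obtain ⟨hab, hRS⟩ := h
      have hR2 := List.pairwise_cons.1 hR
      have hS2 := List.pairwise_cons.1 hS
      simp only [down, phi_of_pairwise _ hR2.2] at hR'
      simp only [List.count_cons, beq_iff_eq] at hlt
      by_cases h1 : (if a = k + 1 then 1 else 0) < R.count k
      · rw [if_pos h1] at hR'
        obtain ⟨v', hv, rfl⟩ := Option.map_eq_some_iff.1 hR'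
        refine ⟨hab, ih hR2.2 hS2.2 hRS hv ?_⟩
        by_cases ha : a = k
        · by_cases hb : b = k + 1
          · simp [ha, hb] at hlt; omega
          · have : S.count (k + 1) = 0 :=
              List.count_eq_zero.2 fun hk => by have := hS2.1 _ hk; omega
            split_ifs at h1 <;> omega
        · simp [ha] at hlt; omega
      · rw [if_neg h1] at hR'
        split_ifs at hR' with h2
        subst h2
        cases hR'
        simp at h1
        refine ⟨?_, hRS⟩
        have : R.count a = 0 := List.count_eq_zero.2 h1
        have : b ≠ a + 1 := by rintro rfl; simp [this] at hlt
        omega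

/-- The last clause feeds the induction: `phi k R < eps k (rowWord T)` is exactly the condition
under which `up k` acts below a row `R` placed on top of `T`. -/
theorem IsTab.exists_of_up {k : ℕ} {T : List (List ℕ)} {w : List ℕ} (hT : IsTab T)
    (h : up k (rowWord T) = some w) : ∃ T', rowWord T' = w ∧ IsTab T' ∧
      T'.map List.length = T.map List.length ∧ ∀ R : List ℕ, R.Pairwise (· ≤ ·) →
        Over R (T.headD []) → phi k R < eps k (rowWord T) → Over R (T'.headD []) := by
  induction T generalizing w with
  | nil => simp [up] at h
  | cons R T ih =>
    obtain ⟨h1, h2, h3, h4⟩ := hT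
    rw [rowWord_cons, up_append] at h
    split_ifs at h with hlt
    · obtain ⟨v, hv, rfl⟩ := Option.map_eq_some_iff.1 h
      obtain ⟨T', rfl, h5, h6, h7⟩ := ih h4 hv
      refine ⟨R :: T', by rw [rowWord_cons], ⟨h1, h2, h7 R h1 h3 hlt, h5⟩, by simp [h6], ?_⟩
      intro R' _ hR' _
      exact hR'
    · obtain ⟨R', hv, rfl⟩ := Option.map_eq_some_iff.1 h
      refine ⟨R' :: T, by rw [rowWord_cons], ⟨pairwise_of_up hv h1, ?_,
        over_mono h3 (rowLE_of_up hv) (rowLE_refl _), h4⟩, by simp [length_of_up hv], ?_⟩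
      · rintro rfl
        have := length_of_up hv
        simp at this
        exact h2 (List.length_eq_zero_iff.1 this.symm)
      -- Here `up k` acts on `R`, so the lower rows contribute no unpaired `k + 1`, and `hphi`
      -- compares the `k` of `U` with the `k + 1` of `R`.
      · intro U hU hUR hphi
        refine over_of_up_right hU h1 hUR hv ?_
        rw [rowWord_cons, eps_append] at hphi
        rw [← phi_of_pairwise _ hU, ← eps_of_pairwise _ h1]
        omega

theorem count_head_le_eps {T : List (List ℕ)} (hT : IsTab T) (k : ℕ) :
    (T.headD []).count (k + 1) ≤ eps k (rowWord T) := by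
  cases T with
  | nil => simp
  | cons R T =>
    rw [List.headD_cons, rowWord_cons, eps_append, eps_of_pairwise _ hT.1]
    exact Nat.le_add_right _ _

theorem IsTab.pairwise_head {T : List (List ℕ)} (hT : IsTab T) :
    (T.headD []).Pairwise (· ≤ ·) := by
  cases T with
  | nil => simp
  | cons R T => exact hT.1

/-- Lowering only increases entries, so a row above the changed one never causes a conflict; only
the row below it needs an argument. -/
theorem IsTab.exists_of_down {k : ℕ} {T : List (List ℕ)} {w : List ℕ} (hT : IsTab T)
    (h : down k (rowWord T) = some w) : ∃ T', rowWord T' = w ∧ IsTab T' ∧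
      T'.map List.length = T.map List.length ∧ RowLE (T.headD []) (T'.headD []) := by
  induction T generalizing w with
  | nil => simp [down] at h
  | cons R T ih =>
    obtain ⟨h1, h2, h3, h4⟩ := hT
    rw [rowWord_cons, down_append] at h
    split_ifs at h with hlt
    · obtain ⟨R', hv, rfl⟩ := Option.map_eq_some_iff.1 h
      have hlen := length_of_up (up_of_down hv)
      refine ⟨R' :: T, by rw [rowWord_cons], ⟨pairwise_of_down hv h1, ?_, ?_, h4⟩,
        by simp [hlen], rowLE_of_down hv⟩
      · rintro rfl
        exact h2 (List.length_eq_zero_iff.1 hlen)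
      · refine over_of_down_left h1 h4.pairwise_head h3 hv ?_
        rw [← phi_of_pairwise _ h1]
        exact (count_head_le_eps h4 k).trans_lt hlt
    · obtain ⟨v, hv, rfl⟩ := Option.map_eq_some_iff.1 h
      obtain ⟨T', rfl, h5, h6, h7⟩ := ih h4 hv
      exact ⟨R :: T', by rw [rowWord_cons],
        ⟨h1, h2, over_mono h3 (rowLE_refl _) h7, h5⟩, by simp [h6], rowLE_refl _⟩

/-! ### Highest weight words and the unique tableau in a class. -/

/-- Highest weight words. -/
def IsHW (w : List ℕ) : Prop := ∀ k, eps k w = 0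

theorem exists_up_of_not_isHW {w : List ℕ} (h : ¬ IsHW w) : ∃ k w', up k w = some w' := by
  simp only [IsHW, not_forall] at h
  obtain ⟨k, hk⟩ := h
  rw [← up_eq_none_iff] at hk
  exact ⟨k, Option.ne_none_iff_exists'.1 hk⟩

theorem CEquiv.isHW {u v : List ℕ} (h : CEquiv u v) (hu : IsHW u) : IsHW v :=
  fun k => (h.eps_eq k).symm.trans (hu k)

/-- The tableau with row lengths `l` whose rows are constant with values `p`, `p + 1`, …. -/
def yam (p : ℕ) : List ℕ → List (List ℕ)
  | [] => []
  | m :: l => List.replicate m p :: yam (p + 1) l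

theorem lt_of_over {p : ℕ} {R S : List ℕ} (h : Over R S) (hR : ∀ x ∈ R, p ≤ x) :
    ∀ x ∈ S, p + 1 ≤ x := by
  induction R generalizing S with
  | nil => cases S <;> simp_all [Over]
  | cons a R ih =>
    cases S with
    | nil => simp
    | cons b S =>
      have h1 := ih h.2 fun x hx => hR x (by simp [hx])
      have h2 := hR a (by simp)
      have h3 := h.1
      intro x hx
      rcases List.mem_cons.1 hx with rfl | hx
      · omega
      · exact h1 x hx

theorem eps_le_of_append_left {k : ℕ} {u v : List ℕ} (h : eps k (u ++ v) = 0) :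
    eps k u ≤ phi k v ∧ eps k v = 0 := by
  rw [eps_append] at h
  omega

/-- Here `v` stands for the rows already treated, with letters below `p`. A letter `k + 1 > p` in
the next row would need a letter `k ≥ p` of `v` as partner. -/
theorem IsTab.eq_yam_aux {T : List (List ℕ)} (hT : IsTab T) (p : ℕ) (v : List ℕ)
    (h1 : ∀ x ∈ T.headD [], p ≤ x) (h2 : ∀ x ∈ v, x < p) (h3 : IsHW (rowWord T ++ v)) :
    T = yam p (T.map List.length) := by
  induction T generalizing p v with
  | nil => rfl
  | cons R T ih =>
    obtain ⟨h4, h5, h6, h7⟩ := hT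
    have h8 : IsHW (rowWord T ++ (R ++ v)) := by simpa [rowWord_cons] using h3
    have hR : ∀ x ∈ R, x = p := by
      intro x hx
      by_contra hne
      have h9 := h1 x hx
      obtain ⟨k, rfl⟩ : ∃ k, x = k + 1 := ⟨x - 1, by simp at h1; omega⟩
      have h10 := (eps_le_of_append_left (eps_le_of_append_left (h8 k)).2).1
      rw [eps_of_pairwise k h4] at h10
      have h11 := phi_le_count k v
      have h12 : v.count k = 0 := List.count_eq_zero.2 fun hk => by have := h2 k hk; omega
      have := List.count_pos_iff.2 hx
      omega
    rw [List.map_cons, yam, ← ih h7 (p + 1) (R ++ v) (lt_of_over h6 fun x hx => (hR x hx).ge) _ h8,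
      ← List.eq_replicate_of_mem hR]
    intro x hx
    rcases List.mem_append.1 hx with hx | hx
    · have := hR x hx; omega
    · have := h2 x hx; omega

theorem IsTab.eq_yam {T : List (List ℕ)} (hT : IsTab T) (h : IsHW (rowWord T)) :
    T = yam 0 (T.map List.length) :=
  hT.eq_yam_aux 0 [] (by simp) (by simp) (by simpa using h)

theorem count_yam (p x : ℕ) (l : List ℕ) :
    (rowWord (yam p l)).count x = if x < p then 0 else l.getD (x - p) 0 := by
  induction l generalizing p with
  | nil => simp [yam]
  | cons m l ih =>
    rw [yam, rowWord_cons, List.count_append, ih, List.count_replicate]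
    rcases lt_trichotomy x p with h | rfl | h
    · simp [h, show x < p + 1 by omega]; omega
    · simp
    · obtain ⟨d, rfl⟩ : ∃ d, x = p + 1 + d := ⟨x - (p + 1), by omega⟩
      simp [show ¬ (p + 1 + d < p) by omega, show p + 1 + d - p = d + 1 by omega,
        show p ≠ p + 1 + d by omega]
      intro h
      omega

/-- The default value 0 hides trailing zeros, so the entries must be nonzero. -/
theorem list_eq_of_getD {l l' : List ℕ} (h : ∀ x, l.getD x 0 = l'.getD x 0)
    (hl : ∀ x ∈ l, x ≠ 0) (hl' : ∀ x ∈ l', x ≠ 0) : l = l' := by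
  induction l generalizing l' with
  | nil =>
    cases l' with
    | nil => rfl
    | cons b l' =>
      have := h 0
      simp at this hl'
      omega
  | cons a l ih =>
    cases l' with
    | nil =>
      have := h 0
      simp at this hl
      omega
    | cons b l' =>
      have h0 := h 0
      simp at h0
      rw [h0, ih (fun x => by simpa using h (x + 1)) (fun x hx => hl x (by simp [hx]))
        (fun x hx => hl' x (by simp [hx]))]

theorem IsTab.lengths_ne_zero {T : List (List ℕ)} (hT : IsTab T) :
    ∀ x ∈ T.map List.length, x ≠ 0 := by
  induction T with
  | nil => simp
  | cons R T ih =>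
    obtain ⟨-, h2, -, h4⟩ := hT
    intro x hx
    rcases List.mem_cons.1 hx with rfl | hx
    · simpa using h2
    · exact ih h4 x hx

/-- In a highest weight tableau the number of letters `x` is the length of row `x`, so the content
gives the shape. -/
theorem IsTab.eq_of_isHW_of_perm {T T' : List (List ℕ)} (hT : IsTab T) (hT' : IsTab T')
    (h : IsHW (rowWord T)) (h' : IsHW (rowWord T')) (hp : (rowWord T).Perm (rowWord T')) :
    T = T' := by
  have h1 := hT.eq_yam h
  have h2 := hT'.eq_yam h'
  rw [h1, h2]
  congr 1
  refine list_eq_of_getD (fun x => ?_) hT.lengths_ne_zero hT'.lengths_ne_zero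
  have := hp.count_eq x
  rw [h1, h2, count_yam, count_yam] at this
  simpa using this

theorem rowWord_inj {T T' : List (List ℕ)} (h : rowWord T = rowWord T')
    (hs : T.map List.length = T'.map List.length) : T = T' := by
  induction T generalizing T' with
  | nil => simpa [eq_comm] using hs
  | cons R T ih =>
    cases T' with
    | nil => simp at hs
    | cons R' T' =>
      simp only [List.map_cons, List.cons.injEq] at hs
      rw [rowWord_cons, rowWord_cons] at h
      obtain ⟨h1, h2⟩ := List.append_inj' h hs.1
      rw [h2, ih h1 hs.2]

/-- Both tableaux are raised in parallel until they reach highest weight, where content decides.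
Lowering is deterministic and shapes are preserved, so equality descends. -/
theorem IsTab.eq_of_cEquiv {T T' : List (List ℕ)} (hT : IsTab T) (hT' : IsTab T')
    (h : CEquiv (rowWord T) (rowWord T')) : T = T' := by
  induction hN : (rowWord T).sum using Nat.strong_induction_on generalizing T T' with
  | _ N ih =>
  by_cases hw : IsHW (rowWord T)
  · exact hT.eq_of_isHW_of_perm hT' hw (h.isHW hw) h.perm
  · obtain ⟨k, w, hk⟩ := exists_up_of_not_isHW hw
    obtain ⟨w', hk', hww⟩ := h.exists_up hk
    obtain ⟨U, rfl, hU, hs, -⟩ := hT.exists_of_up hk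
    obtain ⟨U', rfl, hU', hs', -⟩ := hT'.exists_of_up hk'
    have hsum := sum_of_up hk
    have := ih _ (by omega) hU hU' hww rfl
    subst this
    refine rowWord_inj ?_ (hs.symm.trans hs')
    have h1 := down_of_up hk
    rw [down_of_up hk'] at h1
    exact (Option.some.inj h1).symm

theorem tabMul_eq_iff {S T S' T' : List (List ℕ)} (hS : IsTab S) (hS' : IsTab S') :
    tabMul S T = tabMul S' T' ↔
      CEquiv (rowWord S ++ rowWord T) (rowWord S' ++ rowWord T') := by
  constructor
  · intro h
    refine (cEquiv_tabMul hS T).trans ?_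
    rw [h]
    exact (cEquiv_tabMul hS' T').symm
  · intro h
    exact (hS.tabMul T).eq_of_cEquiv (hS'.tabMul T')
      ((cEquiv_tabMul hS T).symm.trans (h.trans (cEquiv_tabMul hS' T')))

theorem exists_isTab_cEquiv (w : List ℕ) : ∃ T, IsTab T ∧ CEquiv w (rowWord T) :=
  ⟨_, tabMul_aux (T := []) w trivial⟩

theorem cEquiv_of_isHW {u v : List ℕ} (hu : IsHW u) (hv : IsHW v) (h : u.Perm v) :
    CEquiv u v := by
  obtain ⟨T, hT, huT⟩ := exists_isTab_cEquiv u
  obtain ⟨T', hT', hvT⟩ := exists_isTab_cEquiv v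
  have := hT.eq_of_isHW_of_perm hT' (huT.isHW hu) (hvT.isHW hv)
    (huT.perm.symm.trans (h.trans hvT.perm))
  subst this
  exact huT.trans hvT.symm

/-! ### Rectangular tableaux -/

/-- Semistandard tableaux with `r` rows of length `s`. -/
def IsRect (r s : ℕ) (T : List (List ℕ)) : Prop :=
  IsTab T ∧ T.map List.length = List.replicate r s

/-- The rows of a rectangular tableau whose raising operators vanish except for the one that
creates a letter `a - 1`; `prev` is the row on top of it and `p` its letter `< a`. -/
def IsStep (a : ℕ) : ℕ → List ℕ → List (List ℕ) → Prop
  | _, _, [] => True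
  | p, prev, R :: T => (∀ x, a ≤ x → R.count (x + 1) = prev.count x) ∧
      (∀ x, x < a → x ≠ p → R.count x = 0) ∧ IsStep a (p + 1) R T

/-- Summing `h1` over all letters from `x` on reverses the tail inequality `h2`. The tails therefore
agree, and so do their differences. -/
theorem count_eq_of_le_of_countP_le {a : ℕ} {P R : List ℕ}
    (h1 : ∀ x, a ≤ x → R.count (x + 1) ≤ P.count x)
    (h2 : ∀ x, P.countP (x ≤ ·) ≤ R.countP (x + 1 ≤ ·)) :
    ∀ x, a ≤ x → R.count (x + 1) = P.count x := by
  have hs : ∀ (L : List ℕ) (x : ℕ), L.countP (x ≤ ·) = L.count x + L.countP (x + 1 ≤ ·) := by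
    intro L x
    induction L with
    | nil => simp
    | cons y L ih =>
      simp only [List.countP_cons, List.count_cons, ih, beq_iff_eq, decide_eq_true_eq]
      split_ifs <;> omega
  have hle : ∀ d x, a ≤ x → R.countP (x + 1 ≤ ·) + P.countP (x + d ≤ ·) ≤
      P.countP (x ≤ ·) + R.countP (x + d + 1 ≤ ·) := by
    intro d
    induction d with
    | zero => intro x _; simp; omega
    | succ d ih =>
      intro x hx
      have e1 := ih x hx
      have e2 := h1 (x + d) (by omega)
      have e3 := hs P (x + d)
      have e4 := hs R (x + d + 1)
      simp only [← add_assoc] at *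
      omega
  have heq : ∀ x, a ≤ x → R.countP (x + 1 ≤ ·) = P.countP (x ≤ ·) := by
    intro x hx
    refine le_antisymm ?_ (h2 x)
    -- `R.sum` bounds every letter of `R`, so the upper tail of `R` is empty here.
    have e1 := hle (R.sum + 1) x hx
    have e2 : R.countP (x + (R.sum + 1) + 1 ≤ ·) = 0 := by
      rw [List.countP_eq_zero]
      intro y hy
      have := List.le_sum_of_mem hy
      simp
      omega
    omega
  intro x hx
  have e1 := heq x hx
  have e2 := heq (x + 1) (by omega)
  have e3 := hs P x
  have e4 := hs R (x + 1)
  omega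

theorem countP_le_of_over {P R : List ℕ} (h : Over P R) (hl : P.length = R.length) (x : ℕ) :
    P.countP (x ≤ ·) ≤ R.countP (x + 1 ≤ ·) := by
  induction P generalizing R with
  | nil => simp
  | cons a P ih =>
    cases R with
    | nil => simp at hl
    | cons b R =>
      have h1 := ih h.2 (by simpa using hl)
      have h2 := h.1
      simp only [List.countP_cons, decide_eq_true_eq]
      split_ifs <;> omega

/-- Here `v` is the word of the rows above. Vanishing `eps` bounds the `x + 1` of the next row by
the unpaired `x` of `v`; for `x ≥ a` these number `prev.count x`, and equal row lengths with strict
columns force equality. All `x` of `prev` are then used up, so the invariant `h2` passes to the next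
row. -/
theorem isStep_of_eps {a s : ℕ} {T : List (List ℕ)} (hT : IsTab T) (p : ℕ) (prev v : List ℕ)
    (hl : ∀ R ∈ T, R.length = s)
    (h1 : T ≠ [] → ∀ x, prev.countP (x ≤ ·) ≤ (T.headD []).countP (x + 1 ≤ ·))
    (h2 : ∀ x, a ≤ x → phi x v = prev.count x) (h3 : ∀ x, p ≤ x → x < a → x ∉ v)
    (h4 : ∀ x ∈ T.headD [], p ≤ x) (h5 : ∀ k, k + 1 ≠ a → eps k (rowWord T ++ v) = 0) :
    IsStep a p prev T := by
  induction T generalizing p prev v with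
  | nil => trivial
  | cons R T ih =>
    obtain ⟨hR, hne, hov, hT⟩ := hT
    have h1 := h1 (by simp)
    simp only [List.headD_cons] at h1 h4
    have h6 : ∀ k, k + 1 ≠ a → eps k (rowWord T ++ (R ++ v)) = 0 := by
      simpa [rowWord_cons] using h5
    have h7 : ∀ k, k + 1 ≠ a → R.count (k + 1) ≤ phi k v := by
      intro k hk
      have := (eps_le_of_append_left (eps_le_of_append_left (h6 k hk)).2).1
      rwa [eps_of_pairwise k hR] at this
    have h8 : ∀ x, a ≤ x → R.count (x + 1) = prev.count x := by
      refine count_eq_of_le_of_countP_le (fun x hx => ?_) h1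
      rw [← h2 x hx]
      exact h7 x (by omega)
    have h9 : ∀ x, x < a → x ≠ p → R.count x = 0 := by
      intro x hx hxp
      by_contra hne
      have h10 : x ∈ R := List.count_pos_iff.1 (by omega)
      have h11 := h4 x h10
      obtain ⟨k, rfl⟩ : ∃ k, x = k + 1 := ⟨x - 1, by omega⟩
      have h12 := h7 k (by omega)
      have h13 := phi_le_count k v
      have h14 : v.count k = 0 := List.count_eq_zero.2 (h3 k (by omega) (by omega))
      omega
    refine ⟨h8, h9, ih hT (p + 1) R (R ++ v) (fun S hS => hl S (by simp [hS])) ?_ ?_ ?_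
      (lt_of_over hov h4) h6⟩
    · intro hTne
      obtain ⟨S, T, rfl⟩ := List.exists_cons_of_ne_nil hTne
      exact countP_le_of_over hov (by rw [hl R (by simp)]; simp [hl S])
    · intro x hx
      rw [phi_append, h2 x hx, eps_of_pairwise x hR, h8 x hx, phi_of_pairwise x hR]
      omega
    · intro x hx hxa hxv
      rcases List.mem_append.1 hxv with hxv | hxv
      · have := h9 x hxa (by omega)
        exact List.count_eq_zero.1 this hxv
      · exact h3 x (by omega) hxa hxv

theorem IsStep.count_eq_zero {a p : ℕ} {prev : List ℕ} {T : List (List ℕ)}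
    (h : IsStep a p prev T) {x : ℕ} (hx : x < a) (hxp : x < p) : (rowWord T).count x = 0 := by
  induction T generalizing p prev with
  | nil => simp
  | cons R T ih =>
    obtain ⟨-, h2, h3⟩ := h
    rw [rowWord_cons, List.count_append, ih h3 (by omega), h2 x hx (by omega)]

theorem perm_of_count_eq {a : ℕ} {R R' : List ℕ} (hl : R.length = R'.length)
    (h : ∀ x, x ≠ a → R.count x = R'.count x) : R.Perm R' := by
  rw [List.perm_iff_count]
  intro x
  by_cases hx : x = a
  · subst hx
    have h1 : (R.filter (· ≠ x)).Perm (R'.filter (· ≠ x)) := by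
      rw [List.perm_iff_count]
      intro y
      by_cases hy : y = x
      · subst hy
        rw [List.count_eq_zero.2 (by simp), List.count_eq_zero.2 (by simp)]
      · rw [List.count_filter (by simpa using hy), List.count_filter (by simpa using hy), h y hy]
    have h2 := h1.length_eq
    have h3 : ∀ L : List ℕ, L.length = L.count x + (L.filter (· ≠ x)).length := by
      intro L
      rw [List.length_eq_countP_add_countP (p := (· == x)), List.count, ← List.countP_eq_length_filter]
      congr 2
      funext y
      by_cases hy : y = x <;> simp [hy]
    have := h3 R
    have := h3 R'
    omega
  · exact h x hx

/-- Row by row: letters above `a` are copied from the row above, the only possible letter below `a`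
is `p`, which occurs in no later row and is counted by the content, and the row length leaves the
number of letters `a`. -/
theorem IsStep.eq {a p : ℕ} {prev : List ℕ} {T T' : List (List ℕ)} (hT : IsTab T)
    (hT' : IsTab T') (hs : T.map List.length = T'.map List.length) (h : IsStep a p prev T)
    (h' : IsStep a p prev T')
    (hc : ∀ x < a, (rowWord T).count x = (rowWord T').count x) : T = T' := by
  induction T generalizing p prev T' with
  | nil => simpa [eq_comm] using hs
  | cons R T ih =>
    cases T' with
    | nil => simp at hs
    | cons R' T' =>
      simp only [List.map_cons, List.cons.injEq] at hs
      obtain ⟨h1, h2, h3⟩ := h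
      obtain ⟨h1', h2', h3'⟩ := h'
      obtain ⟨g1, -, -, g4⟩ := hT
      obtain ⟨g1', -, -, g4'⟩ := hT'
      simp only [rowWord_cons, List.count_append] at hc
      have hcR : ∀ x, x ≠ a → R.count x = R'.count x := by
        intro x hx
        rcases lt_or_gt_of_ne hx with hx | hx
        · by_cases hxp : x = p
          · have := hc x hx
            rw [h3.count_eq_zero hx (by omega), h3'.count_eq_zero hx (by omega)] at this
            simpa using this
          · rw [h2 x hx hxp, h2' x hx hxp]
        · obtain ⟨k, rfl⟩ : ∃ k, x = k + 1 := ⟨x - 1, by omega⟩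
          rw [h1 k (by omega), h1' k (by omega)]
      have hRR : R = R' :=
        (perm_of_count_eq hs.1 hcR).eq_of_pairwise (fun _ _ _ _ => le_antisymm) g1 g1'
      subst hRR
      rw [ih g4 g4' hs.2 h3 h3' fun x hx => by have := hc x hx; omega]

theorem IsRect.eq_of_eps {r s a : ℕ} {T T' : List (List ℕ)} (hT : IsRect r s T)
    (hT' : IsRect r s T') (h : ∀ k, k + 1 ≠ a → eps k (rowWord T) = 0)
    (h' : ∀ k, k + 1 ≠ a → eps k (rowWord T') = 0) (hp : (rowWord T).Perm (rowWord T')) :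
    T = T' := by
  have key : ∀ T, IsRect r s T → (∀ k, k + 1 ≠ a → eps k (rowWord T) = 0) →
      IsStep a 0 [] T := by
    intro T hT h
    refine isStep_of_eps (s := s) hT.1 0 [] [] ?_ (by simp) (by simp) (by simp) (by simp)
      (by simpa using h)
    intro R hR
    have : R.length ∈ T.map List.length := List.mem_map_of_mem hR
    rw [hT.2] at this
    exact List.eq_of_mem_replicate this
  exact (key T hT h).eq hT.1 hT'.1 (hT.2.trans hT'.2.symm) (key T' hT' h')
    fun x _ => hp.count_eq x

/-! ### Tensor products of two rectangles. -/

/-- Words of pairs of rectangular tableaux. -/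
def PairWord (r s a i : ℕ) (w : List ℕ) : Prop :=
  ∃ c b, IsRect r s c ∧ IsRect a i b ∧ w = rowWord c ++ rowWord b

theorem PairWord.up {r s a i k : ℕ} {w w' : List ℕ} (h : PairWord r s a i w)
    (hw : up k w = some w') : PairWord r s a i w' := by
  obtain ⟨c, b, hc, hb, rfl⟩ := h
  rw [up_append] at hw
  split_ifs at hw
  · obtain ⟨u, hu, rfl⟩ := Option.map_eq_some_iff.1 hw
    obtain ⟨c', rfl, h1, h2, -⟩ := hc.1.exists_of_up hu
    exact ⟨c', b, ⟨h1, h2.trans hc.2⟩, hb, rfl⟩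
  · obtain ⟨u, hu, rfl⟩ := Option.map_eq_some_iff.1 hw
    obtain ⟨b', rfl, h1, h2, -⟩ := hb.1.exists_of_up hu
    exact ⟨c, b', hc, ⟨h1, h2.trans hb.2⟩, rfl⟩

theorem PairWord.down {r s a i k : ℕ} {w w' : List ℕ} (h : PairWord r s a i w)
    (hw : down k w = some w') : PairWord r s a i w' := by
  obtain ⟨c, b, hc, hb, rfl⟩ := h
  rw [down_append] at hw
  split_ifs at hw
  · obtain ⟨u, hu, rfl⟩ := Option.map_eq_some_iff.1 hw
    obtain ⟨b', rfl, h1, h2, -⟩ := hb.1.exists_of_down hu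
    exact ⟨c, b', hc, ⟨h1, h2.trans hb.2⟩, rfl⟩
  · obtain ⟨u, hu, rfl⟩ := Option.map_eq_some_iff.1 hw
    obtain ⟨c', rfl, h1, h2, -⟩ := hc.1.exists_of_down hu
    exact ⟨c', b, ⟨h1, h2.trans hc.2⟩, hb, rfl⟩

/-- The right factor is itself of highest weight, with constant rows `0, …, a - 1`. Its only letters
left unpaired are the `a - 1` of the last row, so the left factor can have nonzero `eps k` only for
`k + 1 = a`. -/
theorem PairWord.eq_of_isHW {r s a i : ℕ} {w w' : List ℕ} (h : PairWord r s a i w)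
    (h' : PairWord r s a i w') (hw : IsHW w) (hw' : IsHW w') (hp : w.Perm w') : w = w' := by
  obtain ⟨c, b, hc, hb, rfl⟩ := h
  obtain ⟨c', b', hc', hb', rfl⟩ := h'
  have hby : b = yam 0 (List.replicate a i) := by
    rw [← hb.2]
    exact hb.1.eq_yam fun k => (eps_le_of_append_left (hw k)).2
  have hby' : b' = yam 0 (List.replicate a i) := by
    rw [← hb'.2]
    exact hb'.1.eq_yam fun k => (eps_le_of_append_left (hw' k)).2
  have hbb : b = b' := hby.trans hby'.symm
  subst hbb
  have hphi : ∀ k, k + 1 ≠ a → phi k (rowWord b) = 0 := by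
    intro k hk
    have h1 := phi_add_count k (rowWord b)
    rw [(eps_le_of_append_left (hw k)).2, hby, count_yam, count_yam] at h1
    rw [hby]
    rcases lt_or_ge (k + 1) a with h2 | h2
    · simpa [List.getD_eq_getElem?_getD, List.getElem?_replicate, h2, show k < a by omega] using h1
    · simpa [List.getD_eq_getElem?_getD, List.getElem?_replicate, show ¬ k + 1 < a by omega,
        show ¬ k < a by omega] using h1
  have hcc : c = c' := by
    refine hc.eq_of_eps (a := a) hc' (fun k hk => ?_) (fun k hk => ?_)
      ((List.perm_append_right_iff _).1 hp)
    · have := (eps_le_of_append_left (hw k)).1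
      have := hphi k hk
      omega
    · have := (eps_le_of_append_left (hw' k)).1
      have := hphi k hk
      omega
  rw [hcc]

/-- The tensor product of two rectangular crystals is multiplicity free. -/
theorem PairWord.eq_of_cEquiv {r s a i : ℕ} {w w' : List ℕ} (h : PairWord r s a i w)
    (h' : PairWord r s a i w') (hww : CEquiv w w') : w = w' := by
  induction hN : w.sum using Nat.strong_induction_on generalizing w w' with
  | _ N ih =>
  by_cases hw : IsHW w
  · exact h.eq_of_isHW h' hw (hww.isHW hw) hww.perm
  · obtain ⟨k, u, hk⟩ := exists_up_of_not_isHW hw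
    obtain ⟨u', hk', huu⟩ := hww.exists_up hk
    have hsum := sum_of_up hk
    have := ih _ (by omega) (h.up hk) (h'.up hk') huu rfl
    subst this
    have h1 := down_of_up hk
    rw [down_of_up hk'] at h1
    exact (Option.some.inj h1).symm

theorem length_rowWord {T : List (List ℕ)} {r s : ℕ} (h : T.map List.length = .replicate r s) :
    (rowWord T).length = r * s := by
  rw [rowWord, List.length_flatten, List.map_reverse, List.sum_reverse, h]
  simp

theorem PairWord.rotate {r s a i : ℕ} {w : List ℕ} (h : PairWord r s a i w) :
    PairWord a i r s (w.rotate (r * s)) := by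
  obtain ⟨c, b, hc, hb, rfl⟩ := h
  refine ⟨b, c, hb, hc, ?_⟩
  rw [← length_rowWord hc.2, List.rotate_append_length_eq]

/-- The words of pairs of rectangular tableaux with the content of `w`. -/
def pairSet (r s a i : ℕ) (w : List ℕ) : Set (List ℕ) := {u | PairWord r s a i u ∧ u.Perm w}

theorem finite_pairSet (r s a i : ℕ) (w : List ℕ) : (pairSet r s a i w).Finite :=
  (w.permutations.toFinset.finite_toSet).subset fun u hu => by simpa using hu.2

/-- Rotation swaps the two factors. It does not respect the crystal structure, but it is injective
and preserves content, which is enough for counting. -/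
theorem ncard_pairSet_le (r s a i : ℕ) (w : List ℕ) :
    (pairSet r s a i w).ncard ≤ (pairSet a i r s w).ncard := by
  refine Set.ncard_le_ncard_of_injOn (fun u => u.rotate (r * s)) ?_ ?_ (finite_pairSet _ _ _ _ _)
  · intro u hu
    exact ⟨hu.1.rotate, (List.rotate_perm _ _).trans hu.2⟩
  · intro u _ v _ huv
    exact List.rotate_injective _ huv

/-- Tensor products of two rectangular crystals are isomorphic in either order. -/
theorem PairWord.exists_cEquiv {r s a i : ℕ} {w : List ℕ} (h : PairWord r s a i w) :
    ∃ w', PairWord a i r s w' ∧ CEquiv w w' := by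
  induction hN : w.sum using Nat.strong_induction_on generalizing r s a i w with
  | _ N ih =>
  subst hN
  -- Raise, swap by induction, lower again. It is needed for both orders of the factors, hence the
  -- fresh shape parameters.
  have step : ∀ {r s a i : ℕ} {u : List ℕ}, PairWord r s a i u → u.sum = w.sum → ¬ IsHW u →
      ∃ u', PairWord a i r s u' ∧ CEquiv u u' := by
    intro r s a i u hu hs hw
    obtain ⟨k, v, hk⟩ := exists_up_of_not_isHW hw
    have hsum := sum_of_up hk
    obtain ⟨v', hv', hvv⟩ := ih v.sum (by omega) (hu.up hk) rfl
    obtain ⟨u', hu', huu⟩ := hvv.exists_down (down_of_up hk)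
    exact ⟨u', hv'.down hu', huu⟩
  by_cases hw : IsHW w
  swap
  · exact step h rfl hw
  by_contra hcon
  have hB : ∀ u ∈ pairSet a i r s w, ¬ IsHW u := fun u hu hhw =>
    hcon ⟨u, hu.1, cEquiv_of_isHW hw hhw hu.2.symm⟩
  choose! g hg1 hg2 using fun u (hu : u ∈ pairSet a i r s w) =>
    step hu.1 hu.2.sum_eq (hB u hu)
  -- If `w` has no partner, all words of the swapped order inject into those of the original order
  -- while missing `w`, so there are strictly fewer of them, contradicting rotation.
  have hsub : g '' pairSet a i r s w ⊆ pairSet r s a i w \ {w} := by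
    rintro _ ⟨u, hu, rfl⟩
    refine ⟨⟨hg1 u hu, (hg2 u hu).perm.symm.trans hu.2⟩, ?_⟩
    intro hgu
    rw [Set.mem_singleton_iff] at hgu
    exact hB u hu ((hg2 u hu).symm.isHW (hgu ▸ hw))
  have hinj : Set.InjOn g (pairSet a i r s w) := by
    intro u hu v hv huv
    refine hu.1.eq_of_cEquiv hv.1 ((hg2 u hu).trans ?_)
    rw [huv]
    exact (hg2 v hv).symm
  have h1 := Set.ncard_le_ncard hsub ((finite_pairSet _ _ _ _ _).sdiff)
  rw [hinj.ncard_image] at h1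
  have h2 := Set.ncard_sdiff_singleton_lt_of_mem (show w ∈ pairSet r s a i w from ⟨h, .refl _⟩)
    (finite_pairSet _ _ _ _ _)
  have h3 := ncard_pairSet_le r s a i w
  omega

theorem IsRect.exists_swap {r s a i : ℕ} {c b : List (List ℕ)} (hc : IsRect r s c)
    (hb : IsRect a i b) : ∃ b' c', IsRect a i b' ∧ IsRect r s c' ∧ tabMul c b = tabMul b' c' := by
  obtain ⟨w', ⟨b', c', hb', hc', rfl⟩, hw⟩ := PairWord.exists_cEquiv ⟨c, b, hc, hb, rfl⟩
  exact ⟨b', c', hb', hc', (tabMul_eq_iff hc.1 hb'.1).2 hw⟩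

theorem IsRect.tabMul_injective {r s a i : ℕ} {c b c' b' : List (List ℕ)} (hc : IsRect r s c)
    (hb : IsRect a i b) (hc' : IsRect r s c') (hb' : IsRect a i b')
    (h : tabMul c b = tabMul c' b') : c = c' ∧ b = b' := by
  have hw := PairWord.eq_of_cEquiv ⟨c, b, hc, hb, rfl⟩ ⟨c', b', hc', hb', rfl⟩
    ((tabMul_eq_iff hc.1 hc'.1).1 h)
  obtain ⟨h1, h2⟩ := List.append_inj hw
    ((length_rowWord hc.2).trans (length_rowWord hc'.2).symm)
  exact ⟨rowWord_inj h1 (hc.2.trans hc'.2.symm), rowWord_inj h2 (hb.2.trans hb'.2.symm)⟩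

/-! ### Transfer to the alphabet `Fin (n + 1)` -/

theorem rowWord_map {α β : Type*} (T : List (List α)) (f : α → β) :
    rowWord (T.map (List.map f)) = (rowWord T).map f := by
  simp [rowWord, ← List.map_reverse, List.map_flatten]

section Map

variable {α β : Type*} [LinearOrder α] [LinearOrder β] {f : α → β}

theorem bumpRow_map (hf : StrictMono f) (x : α) (R : List α) :
    bumpRow (f x) (R.map f) = ((bumpRow x R).1.map f, (bumpRow x R).2.map f) := by
  induction R with
  | nil => rfl
  | cons y R ih =>
    simp only [List.map_cons, bumpRow, hf.lt_iff_lt, ih]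
    split_ifs <;> simp

theorem rowInsert_map (hf : StrictMono f) (T : List (List α)) (x : α) :
    rowInsert (T.map (List.map f)) (f x) = (rowInsert T x).map (List.map f) := by
  induction T generalizing x with
  | nil => rfl
  | cons R T ih =>
    simp only [List.map_cons, rowInsert, bumpRow_map hf]
    cases (bumpRow x R).2 <;> simp [ih]

theorem tabMul_map (hf : StrictMono f) (S T : List (List α)) :
    tabMul (S.map (List.map f)) (T.map (List.map f)) = (tabMul S T).map (List.map f) := by
  rw [tabMul, tabMul, rowWord_map]
  generalize rowWord T = w
  induction w generalizing S with
  | nil => rfl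
  | cons x w ih => simp only [List.map_cons, List.foldl_cons, rowInsert_map hf, ih]

end Map

theorem over_ofFn_iff {s : ℕ} (f g : Fin s → ℕ) :
    Over (List.ofFn f) (List.ofFn g) ↔ ∀ q, f q < g q := by
  induction s with
  | zero => simp
  | succ s ih => simp [List.ofFn_succ, Over, ih, Fin.forall_fin_succ]

theorem isRect_ofFn {r s : ℕ} (hs : 1 ≤ s) (T : Fin r → Fin s → ℕ)
    (h1 : ∀ p q q', q ≤ q' → T p q ≤ T p q') (h2 : ∀ p p' q, p < p' → T p q < T p' q) :
    IsRect r s (List.ofFn fun p => List.ofFn (T p)) := by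
  constructor
  · induction r with
    | zero => simp [IsTab]
    | succ r ih =>
      rw [List.ofFn_succ]
      refine ⟨?_, ?_, ?_, ih _ (fun p => h1 p.succ)
        fun p p' q h => h2 p.succ p'.succ q (Fin.succ_lt_succ_iff.2 h)⟩
      · rw [List.pairwise_ofFn]
        exact fun q q' h => h1 0 q q' h.le
      · rw [ne_eq, List.ofFn_eq_nil_iff]
        omega
      · cases r with
        | zero => simp
        | succ r =>
          rw [List.ofFn_succ, List.headD_cons, over_ofFn_iff]
          exact fun q => h2 _ _ q (Fin.succ_pos _)
  · rw [List.map_ofFn, ← List.ofFn_const]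
    congr 1
    funext p
    simp

theorem IsRect.exists_ofFn {r s : ℕ} {T : List (List ℕ)} (h : IsRect r s T) :
    ∃ f : Fin r → Fin s → ℕ, T = (List.ofFn fun p => List.ofFn (f p)) ∧
      (∀ p q q', q ≤ q' → f p q ≤ f p q') ∧ ∀ p p' q, p < p' → f p q < f p' q := by
  obtain ⟨hT, hl⟩ := h
  induction T generalizing r with
  | nil =>
    cases r with
    | succ r => simp [List.replicate_succ] at hl
    | zero => exact ⟨fun p => p.elim0, by simp, fun p => p.elim0, fun p => p.elim0⟩
  | cons R T ih =>
    cases r with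
    | zero => simp at hl
    | succ r =>
      simp only [List.map_cons, List.replicate_succ, List.cons.injEq] at hl
      obtain ⟨h1, h2, h3, h4⟩ := hT
      obtain ⟨f, rfl, hf1, hf2⟩ := ih h4 hl.2
      obtain ⟨rfl, hl⟩ := hl
      refine ⟨Fin.cons R.get f, by simp [List.ofFn_succ], ?_, ?_⟩
      · refine Fin.cases ?_ ?_
        · intro q q' h
          rcases h.eq_or_lt with rfl | h
          · rfl
          · exact List.pairwise_iff_get.1 h1 q q' h
        · intro p
          simpa using hf1 p
      · have h0 : ∀ (p : Fin r) q, R.get q < f p q := by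
          intro p q
          cases r with
          | zero => exact p.elim0
          | succ r =>
            rw [List.ofFn_succ, List.headD_cons] at h3
            nth_rewrite 1 [← List.ofFn_get R] at h3
            rw [over_ofFn_iff] at h3
            rcases (Fin.zero_le p).eq_or_lt with rfl | hp
            · exact h3 q
            · exact (h3 q).trans (hf2 0 p q hp)
        intro p p' q h
        cases p' using Fin.cases with
        | zero => simp at h
        | succ p' =>
          cases p using Fin.cases with
          | zero => simpa using h0 p' q
          | succ p => simpa using hf2 p p' q (Fin.succ_lt_succ_iff.1 h)

section KR

variable {n a i r s : ℕ}

theorem KR.map_rows (T : KR n r s) : T.rows.map (List.map Fin.val) =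
    List.ofFn fun p => List.ofFn fun q => (T.1 p q : ℕ) := by
  simp [KR.rows, List.map_ofFn, Function.comp_def]

theorem KR.isRect (hs : 1 ≤ s) (T : KR n r s) : IsRect r s (T.rows.map (List.map Fin.val)) := by
  rw [KR.map_rows]
  exact isRect_ofFn hs (fun p q => (T.1 p q : ℕ)) (fun p q q' h => T.2.1 p q q' h)
    fun p p' q h => T.2.2 p p' q h

theorem IsRect.exists_KR {T : List (List ℕ)} (h : IsRect r s T)
    (hn : ∀ x ∈ rowWord T, x < n + 1) : ∃ U : KR n r s, U.rows.map (List.map Fin.val) = T := by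
  obtain ⟨f, rfl, h1, h2⟩ := h.exists_ofFn
  have hf : ∀ p q, f p q < n + 1 := fun p q => hn _ (by simp [rowWord])
  exact ⟨⟨fun p q => ⟨f p q, hf p q⟩, fun p q q' h => h1 p q q' h, fun p p' q h => h2 p p' q h⟩,
    KR.map_rows _⟩

theorem map_val_injective :
    Function.Injective (List.map (List.map (Fin.val : Fin (n + 1) → ℕ))) :=
  List.map_injective_iff.2 (List.map_injective_iff.2 Fin.val_injective)

theorem KR.rows_injective : Function.Injective (KR.rows : KR n r s → _) := by
  intro T T' h
  simp only [KR.rows, List.ofFn_inj] at h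
  refine Subtype.ext (funext fun p => ?_)
  exact List.ofFn_injective (congrFun h p)

theorem KR.tabMul_eq_iff (c : KR n r s) (b : KR n a i) (b' : KR n a i) (c' : KR n r s) :
    tabMul c.rows b.rows = tabMul b'.rows c'.rows ↔
      tabMul (c.rows.map (List.map Fin.val)) (b.rows.map (List.map Fin.val)) =
        tabMul (b'.rows.map (List.map Fin.val)) (c'.rows.map (List.map Fin.val)) := by
  rw [tabMul_map Fin.val_strictMono, tabMul_map Fin.val_strictMono, map_val_injective.eq_iff]

theorem KR.exists_swap (hi : 1 ≤ i) (hs : 1 ≤ s) (c : KR n r s) (b : KR n a i) :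
    ∃ (b' : KR n a i) (c' : KR n r s), tabMul c.rows b.rows = tabMul b'.rows c'.rows := by
  obtain ⟨b', c', hb', hc', h⟩ := IsRect.exists_swap (c.isRect hs) (b.isRect hi)
  have hp := ((BoxBall.tabMul_eq_iff (c.isRect hs).1 hb'.1).1 h).perm
  -- The swapped pair is constructed over `ℕ`; equality of contents brings it back to the alphabet
  -- `Fin (n + 1)`.
  have hn : ∀ x ∈ rowWord b' ++ rowWord c', x < n + 1 := by
    intro x hx
    rw [← hp.mem_iff, rowWord_map, rowWord_map, ← List.map_append] at hx
    obtain ⟨y, -, rfl⟩ := List.mem_map.1 hx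
    exact y.2
  obtain ⟨B, rfl⟩ := hb'.exists_KR fun x hx => hn x (List.mem_append_left _ hx)
  obtain ⟨C, rfl⟩ := hc'.exists_KR fun x hx => hn x (List.mem_append_right _ hx)
  exact ⟨B, C, (KR.tabMul_eq_iff _ _ _ _).2 h⟩

theorem KR.tabMul_injective (hi : 1 ≤ i) (hs : 1 ≤ s) {c c' : KR n r s} {b b' : KR n a i}
    (h : tabMul c.rows b.rows = tabMul c'.rows b'.rows) : c = c' ∧ b = b' := by
  have h' := congrArg (List.map (List.map Fin.val)) h
  rw [← tabMul_map Fin.val_strictMono, ← tabMul_map Fin.val_strictMono] at h'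
  obtain ⟨h1, h2⟩ := (c.isRect hs).tabMul_injective (b.isRect hi) (c'.isRect hs) (b'.isRect hi) h'
  exact ⟨KR.rows_injective (map_val_injective h1), KR.rows_injective (map_val_injective h2)⟩

/-! ### Bijectivity of the combinatorial `R`. -/

theorem combR_eq_iff (hi : 1 ≤ i) (hs : 1 ≤ s) (b b' : KR n a i) (c c' : KR n r s) :
    combR (b, c) = (c', b') ↔ tabMul c.rows b.rows = tabMul b'.rows c'.rows := by
  have h : ∃ y : KR n r s × KR n a i, tabMul c.rows b.rows = tabMul y.2.rows y.1.rows := by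
    obtain ⟨b', c', h⟩ := KR.exists_swap hi hs c b
    exact ⟨(c', b'), h⟩
  have hR : tabMul c.rows b.rows =
      tabMul (combR (b, c)).2.rows (combR (b, c)).1.rows := by
    rw [combR, dif_pos h]
    exact h.choose_spec
  constructor
  · intro heq
    rw [hR, heq]
  · intro heq
    obtain ⟨h1, h2⟩ := KR.tabMul_injective hs hi (hR.symm.trans heq)
    exact Prod.ext h2 h1

theorem combR_bijective (hi : 1 ≤ i) (hs : 1 ≤ s) :
    Function.Bijective (combR : KR n a i × KR n r s → KR n r s × KR n a i) := by
  constructor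
  · rintro ⟨b, c⟩ ⟨b', c'⟩ h
    have h1 := (combR_eq_iff hi hs b (combR (b, c)).2 c (combR (b, c)).1).1 rfl
    have h2 := (combR_eq_iff hi hs b' (combR (b', c')).2 c' (combR (b', c')).1).1 rfl
    rw [h] at h1
    obtain ⟨h3, h4⟩ := KR.tabMul_injective hi hs (h1.trans h2.symm)
    exact Prod.ext h4 h3
  · rintro ⟨c', b'⟩
    obtain ⟨c, b, h⟩ := KR.exists_swap hs hi b' c'
    exact ⟨(b, c), (combR_eq_iff hi hs _ _ _ _).2 h.symm⟩

/-! ### Weights -/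

theorem count_ofFn {α : Type*} [DecidableEq α] {s : ℕ} (f : Fin s → α) (x : α) :
    (List.ofFn f).count x = ∑ q, if f q = x then 1 else 0 := by
  induction s with
  | zero => simp
  | succ s ih => rw [List.ofFn_succ, List.count_cons, Fin.sum_univ_succ, ih, add_comm]; simp

theorem KR.count_rowWord (T : KR n r s) (x : Fin (n + 1)) :
    (rowWord T.rows).count x =
      (Finset.univ.filter fun p : Fin r × Fin s => T.1 p.1 p.2 = x).card := by
  rw [rowWord, (List.reverse_perm T.rows).flatten.count_eq, List.count_flatten, KR.rows,
    List.map_ofFn, List.sum_ofFn, Finset.card_filter, Fintype.sum_prod_type]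
  exact Finset.sum_congr rfl fun p _ => count_ofFn _ _

theorem wt_eq (T : KR n r s) (k : Fin n) :
    wt T k = (rowWord T.rows).count k.castSucc - (rowWord T.rows).count k.succ := by
  rw [wt, KR.count_rowWord, KR.count_rowWord]

theorem wt_add_wt (hi : 1 ≤ i) (hs : 1 ≤ s) {b b' : KR n a i} {c c' : KR n r s}
    (h : combR (b, c) = (c', b')) (k : Fin n) : wt b k + wt c k = wt c' k + wt b' k := by
  rw [combR_eq_iff hi hs, KR.tabMul_eq_iff,
    BoxBall.tabMul_eq_iff (c.isRect hs).1 (b'.isRect hi).1] at h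
  have hp := h.perm
  simp only [rowWord_map, ← List.map_append] at hp
  have hp := (List.map_perm_map_iff Fin.val_injective).1 hp
  have h1 := hp.count_eq k.castSucc
  have h2 := hp.count_eq k.succ
  simp only [List.count_append] at h1 h2
  rw [wt_eq, wt_eq, wt_eq, wt_eq]
  omega

variable {K : Type*} [Field K] {z : Fin n → K}

theorem expWt_mul_expWt (hz : ∀ k, z k ≠ 0) (hi : 1 ≤ i) (hs : 1 ≤ s) {b b' : KR n a i}
    {c c' : KR n r s} (h : combR (b, c) = (c', b')) :
    expWt z b * expWt z c = expWt z c' * expWt z b' := by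
  simp only [expWt, ← Finset.prod_mul_distrib]
  refine Finset.prod_congr rfl fun k _ => ?_
  rw [← zpow_add₀ (hz k), ← zpow_add₀ (hz k), wt_add_wt hi hs h]

theorem sum_piMeas (hQ : charQ z r s ≠ 0) : ∑ u : KR n r s, piMeas z u = 1 := by
  simp only [piMeas, ← Finset.sum_div]
  exact div_self hQ

/-- The outgoing local state is determined by `u` and `b`, so the sum over it has one term. -/
theorem rate_eq_sum (p : KR n r s → K) (u u' : KR n a i) :
    rate p u u' = ∑ b, if (combR (u, b)).2 = u' then p b else 0 := by
  classical
  rw [rate, Finset.sum_filter, Fintype.sum_prod_type]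
  refine Finset.sum_congr rfl fun b _ => ?_
  simp only [Prod.ext_iff]
  rw [Finset.sum_eq_single (combR (u, b)).1]
  · simp
  · intro b' _ hb'
    rw [if_neg]
    exact fun h => hb' h.1.symm
  · simp

theorem sum_rate {p : KR n r s → K} (hp : ∑ b, p b = 1) (u : KR n a i) :
    ∑ u' : KR n a i, rate p u u' = 1 := by
  simp only [rate_eq_sum]
  rw [Finset.sum_comm, ← hp]
  simp

theorem sum_piMeas_mul_rate (hz : ∀ k, z k ≠ 0) (hi : 1 ≤ i) (hs : 1 ≤ s)
    (hQ : charQ z r s ≠ 0) (u' : KR n a i) :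
    ∑ u : KR n a i, piMeas z u * rate (piMeas (r := r) (s := s) z) u u' = piMeas z u' := by
  simp only [rate_eq_sum, Finset.mul_sum]
  rw [← Fintype.sum_prod_type' (f := fun (u : KR n a i) (b : KR n r s) =>
    piMeas z u * if (combR (u, b)).2 = u' then piMeas z b else 0)]
  have h1 : ∀ x : KR n a i × KR n r s,
      (piMeas z x.1 * if (combR (x.1, x.2)).2 = u' then piMeas z x.2 else 0) =
        (fun y : KR n r s × KR n a i => if y.2 = u' then piMeas z y.1 * piMeas z y.2 else 0)
          (combR x) := by
    rintro ⟨u, b⟩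
    have := expWt_mul_expWt hz hi hs (b := u) (c := b)
      (c' := (combR (u, b)).1) (b' := (combR (u, b)).2) rfl
    dsimp only
    split_ifs with h
    · rw [piMeas, piMeas, piMeas, piMeas, div_mul_div_comm, this, div_mul_div_comm,
        mul_comm (charQ z a i)]
    · simp
  rw [Finset.sum_congr rfl fun x _ => h1 x]
  -- The summand depends on `u ⊗ b` only through its image, so the sum runs over all `b' ⊗ u''`; the
  -- condition fixes `u'' = u'`, and `b'` is summed out.
  refine ((combR_bijective hi hs).sum_comp
    (fun y => if y.2 = u' then piMeas z y.1 * piMeas z y.2 else 0)).trans ?_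
  rw [Fintype.sum_prod_type]
  simp only [Finset.sum_ite_eq', Finset.mem_univ, if_true]
  rw [← Finset.sum_mul, sum_piMeas hQ, one_mul]

/-! ### Characters do not vanish -/

theorem KR.nonempty (hr : r ≤ n) : Nonempty (KR n r s) :=
  ⟨⟨fun p _ => ⟨p, by omega⟩, fun _ _ _ _ => le_rfl, fun _ _ _ h => h⟩⟩

theorem expWt_pos {z : Fin n → ℝ} (hz : ∀ k, 0 < z k) (T : KR n r s) : 0 < expWt z T :=
  Finset.prod_pos fun k _ => zpow_pos (hz k) _

theorem charQ_pos {z : Fin n → ℝ} (hz : ∀ k, 0 < z k) (hr : r ≤ n) : 0 < charQ z r s :=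
  have := KR.nonempty (s := s) hr
  Finset.sum_pos (fun T _ => expWt_pos hz T) Finset.univ_nonempty

theorem zGen_ne_zero (k : Fin n) : zGen n k ≠ 0 := by
  rw [zGen, ne_eq, IsFractionRing.to_map_eq_zero_iff]
  exact MvPolynomial.X_ne_zero k

theorem wt_add_nonneg (T : KR n r s) (k : Fin n) : 0 ≤ wt T k + (r * s : ℕ) := by
  have h := Finset.card_filter_le (Finset.univ : Finset (Fin r × Fin s))
    (fun p => T.1 p.1 p.2 = k.succ)
  rw [Finset.card_univ, Fintype.card_prod, Fintype.card_fin, Fintype.card_fin] at h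
  rw [wt]
  omega

/-- Every exponent is at least `-(r * s)`, so multiplying by the monomial `∏ k, zGen n k ^ (r * s)`
clears denominators. The resulting polynomial takes at `(1, …, 1)` the number of tableaux as its
value, which is not zero. -/
theorem charQ_zGen_ne_zero (hr : r ≤ n) : charQ (zGen n) r s ≠ 0 := by
  have := KR.nonempty (s := s) hr
  let P : MvPolynomial (Fin n) ℝ :=
    ∑ T : KR n r s, ∏ k, MvPolynomial.X k ^ (wt T k + (r * s : ℕ)).toNat
  have hP : P ≠ 0 := by
    intro h
    have := congrArg (MvPolynomial.eval fun _ => (1 : ℝ)) h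
    simp [P] at this
  have h1 : algebraMap _ (FractionRing (MvPolynomial (Fin n) ℝ)) P =
      charQ (zGen n) r s * ∏ k, zGen n k ^ (r * s) := by
    simp only [P, map_sum, map_prod, map_pow, charQ, Finset.sum_mul, expWt,
      ← Finset.prod_mul_distrib]
    refine Finset.sum_congr rfl fun T _ => Finset.prod_congr rfl fun k _ => ?_
    rw [← zpow_natCast, ← zpow_natCast, Int.toNat_of_nonneg (wt_add_nonneg T k),
      ← zpow_add₀ (zGen_ne_zero k), zGen]
  intro h
  rw [h, zero_mul, IsFractionRing.to_map_eq_zero_iff] at h1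
  exact hP h1

end KR

end BoxBall

theorem proposition3p1 (n a i r s : ℕ) (ha : 1 ≤ a) (han : a ≤ n) (hi : 1 ≤ i)
    (hr : 1 ≤ r) (hrn : r ≤ n) (hs : 1 ≤ s) :
    -- the combinatorial `R` is a bijection, and it is determined by the tableau product
    (Function.Bijective
        (BoxBall.combR : BoxBall.KR n a i × BoxBall.KR n r s →
          BoxBall.KR n r s × BoxBall.KR n a i) ∧
      ∀ (b b' : BoxBall.KR n a i) (c c' : BoxBall.KR n r s),
        BoxBall.combR (b, c) = (c', b') ↔
          BoxBall.tabMul c.rows b.rows = BoxBall.tabMul b'.rows c'.rows) ∧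
    -- the identities in the field of rational functions in `z_1, …, z_n`
    ((∑ u : BoxBall.KR n a i, BoxBall.piMeas (BoxBall.zGen n) u = 1) ∧
      (∀ u : BoxBall.KR n a i, ∑ u' : BoxBall.KR n a i,
        BoxBall.rate (BoxBall.piMeas (r := r) (s := s) (BoxBall.zGen n)) u u' = 1) ∧
      ∀ u' : BoxBall.KR n a i,
        BoxBall.piMeas (BoxBall.zGen n) u' =
          ∑ u : BoxBall.KR n a i, BoxBall.piMeas (BoxBall.zGen n) u *
            BoxBall.rate (BoxBall.piMeas (r := r) (s := s) (BoxBall.zGen n)) u u') ∧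
    -- the same for positive real values of `z_1, …, z_n`, where the `π` are probability measures
    ∀ z : Fin n → ℝ, (∀ k, 0 < z k) →
      (∀ u : BoxBall.KR n a i, 0 < BoxBall.piMeas z u) ∧
      (∑ u : BoxBall.KR n a i, BoxBall.piMeas z u = 1) ∧
      (∀ u : BoxBall.KR n a i, ∑ u' : BoxBall.KR n a i,
        BoxBall.rate (BoxBall.piMeas (r := r) (s := s) z) u u' = 1) ∧
      ∀ u' : BoxBall.KR n a i,
        BoxBall.piMeas z u' =
          ∑ u : BoxBall.KR n a i, BoxBall.piMeas z u *
            BoxBall.rate (BoxBall.piMeas (r := r) (s := s) z) u u' := by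
  refine ⟨⟨BoxBall.combR_bijective hi hs, fun b b' c c' => BoxBall.combR_eq_iff hi hs b b' c c'⟩,
    ⟨BoxBall.sum_piMeas (BoxBall.charQ_zGen_ne_zero han),
      BoxBall.sum_rate (BoxBall.sum_piMeas (BoxBall.charQ_zGen_ne_zero hrn)),
      fun u' => (BoxBall.sum_piMeas_mul_rate BoxBall.zGen_ne_zero hi hs
        (BoxBall.charQ_zGen_ne_zero hrn) u').symm⟩, fun z hz => ⟨fun u => ?_, ?_, ?_, fun u' => ?_⟩⟩
  · exact div_pos (BoxBall.expWt_pos hz u) (BoxBall.charQ_pos hz han)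
  · exact BoxBall.sum_piMeas (BoxBall.charQ_pos hz han).ne'
  · exact BoxBall.sum_rate (BoxBall.sum_piMeas (BoxBall.charQ_pos hz hrn).ne')
  · exact (BoxBall.sum_piMeas_mul_rate (fun k => (hz k).ne') hi hs
      (BoxBall.charQ_pos hz hrn).ne' u').symm
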